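/- **Theorem.** Let $F_i(\cdot;\xi):\mathbb R^d\to\mathbb R$ be the loss of worker $i\in\{1,\dots,n\}$ on a sample $\xi\sim\mathcal D_i$, let $f_i(x)=\mathbb E_{\xi\sim\mathcal D_i}F_i(x;\xi)$ and $f=\frac1n\sum_{i=1}^n f_i$, and suppose that $f^*=\inf_x f(x)>-\infty$. Assume that, for all $i,x,z$, (1) $\|\nabla f_i(x)-\nabla f_i(z)\|_2\le L\|x-z\|_2$; (2) $\mathbb E_{\xi\sim\mathcal D_i}\|\nabla F_i(x;\xi)-\nabla f_i(x)\|_2^2\le\sigma^2$; (3) $\mathbb E_{\xi\sim\mathcal D_i}\nabla F_i(x;\xi)=\nabla f_i(x)$; and that all workers share the same training data, i.e. $\mathcal D_i$ and $F_i$ do not depend on $i$. The workers run $K\ge1$ iterations of MergeComp with sparsification and step size $\gamma$. The $d$ coordinates are partitioned into groups. All local models $x^{(w)}_t$ start at $x^{(w)}_0=x_0$, and the not yet exchanged gradients $r^{(w)}_t$ start at $r^{(w)}_0=0$. In iteration $t=0,\dots,K-1$ each worker $w$ computes the mini-batch stochastic gradient $g^{(w)}_t$ at $x^{(w)}_t$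 with $M/n\ge1$ fresh independent samples, where $M$ is the total mini-batch size over all workers. In every group a sparsifier selects some of the coordinates (the selection may depend on the worker, on the past, on the current gradients and on additional randomness that is independent of the future samples). Worker $w$ sends $\delta^{(w)}_t$, which is $r^{(w)}_t+g^{(w)}_t$ on the selected coordinates and $0$ elsewhere. With $\Delta_t=\frac1n\sum_w\delta^{(w)}_t$, the updates are $$x^{(w)}_{t+1}=x^{(w)}_t-\gamma\bigl(g^{(w)}_t-\delta^{(w)}_t+\Delta_t\bigr),\qquad r^{(w)}_{t+1}=r^{(w)}_t+g^{(w)}_t-\delta^{(w)}_t .$$ (If all workers select the same coordinates, this is a local SGD step followed by averaging of the local models over the workers on the selected coordinates.) Assume that (4) almost surely, every worker selects every coordinate at least once in any $p\ge1$ consecutive iterations. Let $X_t=[x^{(1)}_t,\dots,x^{(n)}_t]$, so that $X_t\mathbf 1_n/n$ is the average of the local models. If $\gamma=\theta\sqrt{M/K}$ with a constant $\theta>0$, $L\gamma\le1$, $6np^2L^2\gamma^2<1$ and $K\ge12nM\theta^2p^2L^2$, then $$\frac1K\sum_{t=0}^{K-1}\mathbb E\Bigl\|\nabla f\Bigl(\frac{X_t\mathbf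 1_n}{n}\Bigr)\Bigr\|_2^2\le\frac{4\theta^{-1}(f(x_0)-f^*)+2\theta L\sigma^2}{\sqrt{MK}}+\frac{2pn^2\theta^2L^2\sigma^2}{K},$$ all these expectations being finite. In particular the rate is $\mathcal O(1/\sqrt{MK})$ for large $K$: if moreover $K\ge p^2n^4M\theta^2L^2$, the left-hand side is at most $\bigl(4\theta^{-1}(f(x_0)-f^*)+4\theta L\sigma^2\bigr)/\sqrt{MK}$. -/

import Mathlib

open MeasureTheory ProbabilityTheory

noncomputable section

namespace MergeComp

/-- The expected loss `f_i(x) = E_{ξ ∼ D_i} F_i(x; ξ)` of worker `i`. -/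
def localLoss {n d : ℕ} {Ξ : Type*} [MeasurableSpace Ξ]
    (F : Fin n → EuclideanSpace ℝ (Fin d) → Ξ → ℝ) (D : Fin n → Measure Ξ)
    (i : Fin n) (x : EuclideanSpace ℝ (Fin d)) : ℝ :=
  ∫ ξ, F i x ξ ∂(D i)

/-- The objective `f(x) = (1/n) ∑ i, f_i(x)`. -/
def globalLoss {n d : ℕ} {Ξ : Type*} [MeasurableSpace Ξ]
    (F : Fin n → EuclideanSpace ℝ (Fin d) → Ξ → ℝ) (D : Fin n → Measure Ξ)
    (x : EuclideanSpace ℝ (Fin d)) : ℝ :=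
  (1 / (n : ℝ)) * ∑ i, localLoss F D i x

/-- The stochastic gradient `∇F(x; ξ)`: the gradient in the model parameters `x`, for a fixed
sample `ξ`. -/
def stochGrad {d : ℕ} {Ξ : Type*} (F : EuclideanSpace ℝ (Fin d) → Ξ → ℝ)
    (x : EuclideanSpace ℝ (Fin d)) (ξ : Ξ) : EuclideanSpace ℝ (Fin d) :=
  gradient (fun z => F z ξ) x

/-- The mini-batch stochastic gradient, averaged over the `b` samples of the batch. -/
def batchGrad {d b : ℕ} {Ξ : Type*} (F : EuclideanSpace ℝ (Fin d) → Ξ → ℝ)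
    (x : EuclideanSpace ℝ (Fin d)) (ξ : Fin b → Ξ) : EuclideanSpace ℝ (Fin d) :=
  (1 / (b : ℝ)) • ∑ k, stochGrad F x (ξ k)

/-- A choice of coordinates to be exchanged. The `d` coordinates of the model are partitioned into
`y` groups by `grp`, and a separate selection is made inside every group. -/
abbrev Selection {d y : ℕ} (grp : Fin d → Fin y) : Type :=
  (i : Fin y) → Finset {j : Fin d // grp j = i}

/-- Coordinate `j` is selected, inside the group to which it belongs. -/
def Selected {d y : ℕ} {grp : Fin d → Fin y} (S : Selection grp) (j : Fin d) : Prop :=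
  (⟨j, rfl⟩ : {k : Fin d // grp k = grp j}) ∈ S (grp j)

open Classical in
/-- Groupwise sparsification: in each group the selected coordinates are kept (these are the
entries that are communicated), and the other ones are set to zero. -/
def sparsify {d y : ℕ} {grp : Fin d → Fin y} (S : Selection grp)
    (v : EuclideanSpace ℝ (Fin d)) : EuclideanSpace ℝ (Fin d) :=
  WithLp.toLp 2 (fun j => if Selected S j then v j else 0)

/-- The state of the workers: `model w` is the local model of worker `w` (column `w` of the matrix
`X_t`), and `unsent w` is the sum of the gradient entries that worker `w` has computed but not yet
exchanged. -/
structure State (n d : ℕ) where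
  model : Fin n → EuclideanSpace ℝ (Fin d)
  unsent : Fin n → EuclideanSpace ℝ (Fin d)

/-- Worker `w`'s gradients that are not yet exchanged, after its current gradient `g w` has been
computed. -/
def State.pending {n d : ℕ} (s : State n d) (g : Fin n → EuclideanSpace ℝ (Fin d)) (w : Fin n) :
    EuclideanSpace ℝ (Fin d) :=
  s.unsent w + g w

/-- The aggregate of the communicated sparse gradients: the mean over all workers. -/
def State.aggregate {n d y : ℕ} {grp : Fin d → Fin y} (s : State n d)
    (g : Fin n → EuclideanSpace ℝ (Fin d)) (S : Fin n → Selection grp) :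
    EuclideanSpace ℝ (Fin d) :=
  (1 / (n : ℝ)) • ∑ w, sparsify (S w) (s.pending g w)

/-- One iteration with step size `γ`. Worker `w` has computed `g w`, sends the sparsified pending
gradient, and receives the aggregate. The entries that it does not send act on its own model only,
and stay pending; for the entries that it sends, its own accumulated contribution is replaced by the
aggregate. (When all workers select the same coordinates, this is a local SGD step followed by
averaging of the local models on the selected coordinates.) -/
def State.step {n d y : ℕ} {grp : Fin d → Fin y} (γ : ℝ) (s : State n d)
    (g : Fin n → EuclideanSpace ℝ (Fin d)) (S : Fin n → Selection grp) : State n d where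
  model w := s.model w - γ • (g w - sparsify (S w) (s.pending g w) + s.aggregate g S)
  unsent w := s.pending g w - sparsify (S w) (s.pending g w)

/-- The state after `t` iterations: all workers start at `x₀`; in iteration `t` worker `w` uses the
samples `ξ t w 0, …, ξ t w (b-1)` and the selection `S t w`. -/
def run {n d b y : ℕ} {Ξ : Type*} {grp : Fin d → Fin y}
    (F : Fin n → EuclideanSpace ℝ (Fin d) → Ξ → ℝ) (γ : ℝ) (x₀ : EuclideanSpace ℝ (Fin d))
    (ξ : ℕ → Fin n → Fin b → Ξ) (S : ℕ → Fin n → Selection grp) : ℕ → State n d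
  | 0 => { model := fun _ => x₀, unsent := fun _ => 0 }
  | t + 1 =>
      (run F γ x₀ ξ S t).step γ
        (fun w => batchGrad (F w) ((run F γ x₀ ξ S t).model w) (ξ t w)) (S t)

/-- The average `X_t 1_n / n` of the local models. -/
def State.average {n d : ℕ} (s : State n d) : EuclideanSpace ℝ (Fin d) :=
  (1 / (n : ℝ)) • ∑ w, s.model w

end MergeComp

end

/-!
The average `a t` of the local models performs plain SGD steps, because what the workers send and
what they receive cancels in the average (`run_average_succ`); only the gradients are computed at
the local models instead of `a t`. The sum of a local model and `γ` times its unsent gradients is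
the same for all workers (`run_model_add_unsent`), so the squared deviations of the local models
from `a t` sum up to at most `γ ^ 2` times the sum of the squared norms of the unsent gradients.
Almost surely, only gradients of the last `p` iterations are unsent (`residual_eq_window`).

The unsent gradients are split linearly into means and noise. The means cost a factor `p` by
Cauchy-Schwarz. The noise is the delicate part, since the selection may depend on the noise of the
same iteration. But a selection only sets coordinates to zero, hence never increases the norm, and
what survives is orthogonal to the next, fresh noise. So the second moments of the unsent noise add
up to at most `p * σ ^ 2 / b` (`UnbiasedNoise.residual`).

With `V` the mean over the iterations of `L ^ 2 / n` times the expected squared deviation, and `G`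
the mean of the expected squared gradient norms at `a t`, this gives
`V ≤ 2 * X + 4 * p ^ 2 * L ^ 2 * γ ^ 2 * (G + V)` with `X = p * L ^ 2 * γ ^ 2 * σ ^ 2 / b`
(`SharedData.consensus`), and the descent lemma gives
`G ≤ 2 * (f x₀ - f⋆) / (γ * K) + L * γ * σ ^ 2 / (n * b) + V` (`SharedData.descent`).
A single worker has `V = 0`. For `n ≥ 2` the hypothesis on `K` makes the factor of `G + V` at most
`1 / 6`, and solving the two inequalities gives the bound (`sum_le_of_descent_of_consensus`).
-/

noncomputable section

open scoped RealInnerProductSpace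

namespace MergeComp

/-! ### Smooth functions and finite averages -/

section Analysis

variable {V : Type*} [NormedAddCommGroup V] [InnerProductSpace ℝ V]

/-- The descent lemma: a function with `L`-Lipschitz gradient lies below the paraboloid of
curvature `L` that touches it at `x`. -/
lemma descent_lemma [CompleteSpace V] {f : V → ℝ} (hf : Differentiable ℝ f) {L : ℝ}
    (hL : ∀ x z, ‖gradient f x - gradient f z‖ ≤ L * ‖x - z‖) (x y : V) :
    f y ≤ f x + ⟪gradient f x, y - x⟫ + L / 2 * ‖y - x‖ ^ 2 := by
  set v := y - x with hv
  set g : ℝ → ℝ := fun t => f (x + t • v) - t * ⟪gradient f x, v⟫ - L / 2 * ‖v‖ ^ 2 * t ^ 2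
    with hg
  have hline : ∀ t : ℝ, HasDerivAt (fun t : ℝ => f (x + t • v)) ⟪gradient f (x + t • v), v⟫ t := by
    intro t
    have h1 : HasDerivAt (fun t : ℝ => x + t • v) v t := by
      simpa using ((hasDerivAt_id t).smul_const v).const_add x
    have h2 := ((hf (x + t • v)).hasGradientAt.hasFDerivAt).comp_hasDerivAt t h1
    simpa [Function.comp_def] using h2
  have hder : ∀ t : ℝ, HasDerivAt g
      (⟪gradient f (x + t • v), v⟫ - ⟪gradient f x, v⟫ - L / 2 * ‖v‖ ^ 2 * (2 * t)) t := by
    intro t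
    have h1 : HasDerivAt (fun t : ℝ => t * ⟪gradient f x, v⟫) ⟪gradient f x, v⟫ t := by
      simpa using (hasDerivAt_id t).mul_const ⟪gradient f x, v⟫
    have h2 : HasDerivAt (fun t : ℝ => L / 2 * ‖v‖ ^ 2 * t ^ 2) (L / 2 * ‖v‖ ^ 2 * (2 * t)) t := by
      simpa using (hasDerivAt_pow 2 t).const_mul (L / 2 * ‖v‖ ^ 2)
    exact ((hline t).sub h1).sub h2
  have hanti : AntitoneOn g (Set.Icc 0 1) := by
    refine antitoneOn_of_deriv_nonpos (convex_Icc 0 1)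
      (fun t _ => (hder t).continuousAt.continuousWithinAt)
      (fun t _ => (hder t).differentiableAt.differentiableWithinAt) ?_
    intro t ht
    rw [interior_Icc] at ht
    rw [(hder t).deriv, ← inner_sub_left]
    have h1 : ⟪gradient f (x + t • v) - gradient f x, v⟫ ≤ L * (t * ‖v‖) * ‖v‖ := by
      refine (real_inner_le_norm _ _).trans (mul_le_mul_of_nonneg_right ?_ (norm_nonneg v))
      simpa [norm_smul, abs_of_pos ht.1] using hL (x + t • v) x
    linarith [h1, show L * (t * ‖v‖) * ‖v‖ = L / 2 * ‖v‖ ^ 2 * (2 * t) by ring]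
  have h01 := hanti (Set.left_mem_Icc.2 zero_le_one) (Set.right_mem_Icc.2 zero_le_one) zero_le_one
  simp only [hg, one_smul, zero_smul, add_zero, hv, add_sub_cancel] at h01
  rw [hv]
  linarith

lemma norm_add_sq_le_two (u v : V) : ‖u + v‖ ^ 2 ≤ 2 * ‖u‖ ^ 2 + 2 * ‖v‖ ^ 2 := by
  have h1 := parallelogram_law_with_norm ℝ u v
  nlinarith [sq_nonneg ‖u - v‖]

lemma norm_sum_sq_le {ι V : Type*} [SeminormedAddCommGroup V] (s : Finset ι) (v : ι → V) :
    ‖∑ i ∈ s, v i‖ ^ 2 ≤ s.card * ∑ i ∈ s, ‖v i‖ ^ 2 :=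
  (pow_le_pow_left₀ (norm_nonneg _) (norm_sum_le s v) 2).trans sq_sum_le_card_mul_sum_sq

lemma norm_average_sq_le {n : ℕ} (hn : 1 ≤ n) (v : Fin n → V) :
    ‖(1 / (n : ℝ)) • ∑ w, v w‖ ^ 2 ≤ (1 / (n : ℝ)) * ∑ w, ‖v w‖ ^ 2 := by
  have hn0 : (0 : ℝ) < n := by exact_mod_cast hn
  have h := norm_sum_sq_le Finset.univ v
  rw [Finset.card_univ, Fintype.card_fin] at h
  rw [norm_smul, mul_pow, Real.norm_of_nonneg (by positivity)]
  calc (1 / (n : ℝ)) ^ 2 * ‖∑ w, v w‖ ^ 2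
      ≤ (1 / (n : ℝ)) ^ 2 * (n * ∑ w, ‖v w‖ ^ 2) := by gcongr
    _ = (1 / (n : ℝ)) * ∑ w, ‖v w‖ ^ 2 := by field_simp

lemma average_const {n : ℕ} (hn : 1 ≤ n) (u : V) :
    (1 / (n : ℝ)) • ∑ _w : Fin n, u = u := by
  have hn0 : (n : ℝ) ≠ 0 := by positivity
  rw [Finset.sum_const, Finset.card_univ, Fintype.card_fin, ← Nat.cast_smul_eq_nsmul ℝ, smul_smul,
    one_div, inv_mul_cancel₀ hn0, one_smul]

lemma sum_norm_sub_average_sq_le {n : ℕ} (hn : 1 ≤ n) (v : Fin n → V) :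
    ∑ w, ‖v w - (1 / (n : ℝ)) • ∑ w', v w'‖ ^ 2 ≤ ∑ w, ‖v w‖ ^ 2 := by
  have hn0 : (0 : ℝ) < n := by exact_mod_cast hn
  set m := (1 / (n : ℝ)) • ∑ w', v w' with hm
  have hs : ∑ w, v w = (n : ℝ) • m := by
    rw [hm, smul_smul, mul_one_div_cancel hn0.ne', one_smul]
  have h1 : ∑ w, ‖v w - m‖ ^ 2 = ∑ w, ‖v w‖ ^ 2 - n * ‖m‖ ^ 2 := by
    simp_rw [norm_sub_sq_real, Finset.sum_add_distrib, Finset.sum_sub_distrib, ← Finset.mul_sum,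
      ← sum_inner, hs, real_inner_smul_left, real_inner_self_eq_norm_sq]
    simp
    ring
  rw [h1]
  have : 0 ≤ (n : ℝ) * ‖m‖ ^ 2 := by positivity
  linarith

end Analysis

/-! ### The deterministic dynamics -/

section Dynamics

variable {n d b y : ℕ} {Ξ : Type*} {grp : Fin d → Fin y}

/-- The part of a vector that a selection does not send: the selected coordinates are set to
zero. -/
def keep (S : Selection grp) (v : EuclideanSpace ℝ (Fin d)) : EuclideanSpace ℝ (Fin d) :=
  v - sparsify S v

open Classical in
lemma keep_apply (S : Selection grp) (v : EuclideanSpace ℝ (Fin d)) (j : Fin d) :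
    keep S v j = if Selected S j then 0 else v j := by
  by_cases h : Selected S j <;> simp [keep, sparsify, h]

lemma keep_add (S : Selection grp) (u v : EuclideanSpace ℝ (Fin d)) :
    keep S (u + v) = keep S u + keep S v := by
  ext j
  by_cases h : Selected S j <;> simp [keep_apply, h]

lemma norm_keep_le (S : Selection grp) (v : EuclideanSpace ℝ (Fin d)) : ‖keep S v‖ ≤ ‖v‖ := by
  rw [EuclideanSpace.norm_eq, EuclideanSpace.norm_eq]
  refine Real.sqrt_le_sqrt (Finset.sum_le_sum fun j _ => ?_)
  by_cases h : Selected S j <;> simp [keep_apply, h, sq_nonneg]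

/-- What is left, after `m` iterations beginning with iteration `s`, of the vectors
`v s, …, v (s + m - 1)`, when iteration `s` begins with nothing pending and iteration `t` removes
the coordinates selected by `S t`. -/
def residual (S : ℕ → Selection grp) (v : ℕ → EuclideanSpace ℝ (Fin d)) (s : ℕ) :
    ℕ → EuclideanSpace ℝ (Fin d)
  | 0 => 0
  | m + 1 => keep (S (s + m)) (residual S v s m + v (s + m))

lemma residual_add (S : ℕ → Selection grp) (u v : ℕ → EuclideanSpace ℝ (Fin d)) (s m : ℕ) :
    residual S (fun t => u t + v t) s m = residual S u s m + residual S v s m := by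
  induction m with
  | zero => simp [residual]
  | succ m ih => rw [residual, residual, residual, ih, ← keep_add]; congr 1; abel

lemma norm_residual_le (S : ℕ → Selection grp) (v : ℕ → EuclideanSpace ℝ (Fin d)) (s m : ℕ) :
    ‖residual S v s m‖ ≤ ∑ k ∈ Finset.range m, ‖v (s + k)‖ := by
  induction m with
  | zero => simp [residual]
  | succ m ih =>
    rw [residual, Finset.sum_range_succ]
    exact (norm_keep_le _ _).trans ((norm_add_le _ _).trans (by gcongr))

lemma norm_residual_sq_le (S : ℕ → Selection grp) (v : ℕ → EuclideanSpace ℝ (Fin d)) (s m : ℕ) :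
    ‖residual S v s m‖ ^ 2 ≤ m * ∑ k ∈ Finset.range m, ‖v (s + k)‖ ^ 2 := by
  have h := sq_sum_le_card_mul_sum_sq (s := Finset.range m) (f := fun k => ‖v (s + k)‖)
  rw [Finset.card_range] at h
  exact (pow_le_pow_left₀ (norm_nonneg _) (norm_residual_le S v s m) 2).trans h

open Classical in
/-- A coordinate forgets everything that was pending before iteration `s` as soon as it has been
selected once. -/
lemma residual_zero_add_apply (S : ℕ → Selection grp) (v : ℕ → EuclideanSpace ℝ (Fin d))
    (s m : ℕ) (j : Fin d) :
    residual S v 0 (s + m) j = residual S v s m j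
      + if ∃ k < m, Selected (S (s + k)) j then 0 else residual S v 0 s j := by
  induction m with
  | zero => simp [residual]
  | succ m ih =>
    rw [← add_assoc, residual, residual, keep_apply, keep_apply]
    by_cases h : Selected (S (s + m)) j
    · rw [if_pos (by simpa using h), if_pos h, if_pos ⟨m, Nat.lt_succ_self m, h⟩, add_zero]
    · have hiff : (∃ k < m + 1, Selected (S (s + k)) j) ↔ ∃ k < m, Selected (S (s + k)) j := by
        constructor
        · rintro ⟨k, hk, hs⟩
          rcases Nat.lt_succ_iff_lt_or_eq.1 hk with h1 | rfl
          · exact ⟨k, h1, hs⟩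
          · exact absurd hs h
        · rintro ⟨k, hk, hs⟩
          exact ⟨k, hk.trans (Nat.lt_succ_self m), hs⟩
      rw [if_neg (by simpa using h), if_neg h]
      simp only [hiff, PiLp.add_apply, zero_add, ih]
      ring

/-- If every coordinate has been selected during the last `p` iterations, only the vectors of the
last `p` iterations (of all iterations, if `t < p`) are still pending. -/
lemma residual_eq_window {p t : ℕ} (S : ℕ → Selection grp) (v : ℕ → EuclideanSpace ℝ (Fin d))
    (hS : p ≤ t → ∀ j, ∃ s, t - p ≤ s ∧ s < t ∧ Selected (S s) j) :
    residual S v 0 t = residual S v (t - p) (t - (t - p)) := by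
  rcases le_total t p with h | h
  · simp [h]
  · ext j
    obtain ⟨s, h1, h2, h3⟩ := hS h j
    have h4 := residual_zero_add_apply S v (t - p) (t - (t - p)) j
    rwa [Nat.add_sub_cancel' (Nat.sub_le t p), if_pos ⟨s - (t - p), by omega, by
      rwa [Nat.add_sub_cancel' h1]⟩, add_zero] at h4

variable (F : Fin n → EuclideanSpace ℝ (Fin d) → Ξ → ℝ) (γ : ℝ) (x₀ : EuclideanSpace ℝ (Fin d))
  (ξ : ℕ → Fin n → Fin b → Ξ) (S : ℕ → Fin n → Selection grp)

/-- The mini-batch gradient that worker `w` computes in iteration `t`. -/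
def runGrad (t : ℕ) (w : Fin n) : EuclideanSpace ℝ (Fin d) :=
  batchGrad (F w) ((run F γ x₀ ξ S t).model w) (ξ t w)

lemma run_unsent_succ (t : ℕ) (w : Fin n) : (run F γ x₀ ξ S (t + 1)).unsent w
    = keep (S t w) ((run F γ x₀ ξ S t).unsent w + runGrad F γ x₀ ξ S t w) := rfl

lemma run_model_succ (t : ℕ) (w : Fin n) : (run F γ x₀ ξ S (t + 1)).model w
    = (run F γ x₀ ξ S t).model w - γ • (runGrad F γ x₀ ξ S t w
      - sparsify (S t w) ((run F γ x₀ ξ S t).unsent w + runGrad F γ x₀ ξ S t w)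
      + (1 / (n : ℝ)) • ∑ w', sparsify (S t w')
          ((run F γ x₀ ξ S t).unsent w' + runGrad F γ x₀ ξ S t w')) := rfl

lemma run_unsent_eq_residual (t : ℕ) (w : Fin n) : (run F γ x₀ ξ S t).unsent w
    = residual (fun s => S s w) (fun s => runGrad F γ x₀ ξ S s w) 0 t := by
  induction t with
  | zero => rfl
  | succ t ih => rw [run_unsent_succ, residual, ih, zero_add]

/-- The average of the local models performs plain SGD steps: what the workers send and what they
receive cancels in the average. -/
lemma run_average_succ (hn : 1 ≤ n) (t : ℕ) : (run F γ x₀ ξ S (t + 1)).average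
    = (run F γ x₀ ξ S t).average - γ • ((1 / (n : ℝ)) • ∑ w, runGrad F γ x₀ ξ S t w) := by
  simp only [State.average, run_model_succ]
  rw [Finset.sum_sub_distrib, ← Finset.smul_sum, Finset.sum_add_distrib, Finset.sum_sub_distrib,
    smul_sub, smul_comm _ γ, smul_add, smul_sub, average_const hn, sub_add_cancel]

lemma run_average_zero (hn : 1 ≤ n) : (run F γ x₀ ξ S 0).average = x₀ := average_const hn x₀

/-- Local models differ only by the gradients that are not yet exchanged. -/
lemma run_model_add_unsent (t : ℕ) (w w' : Fin n) :
    (run F γ x₀ ξ S t).model w + γ • (run F γ x₀ ξ S t).unsent w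
      = (run F γ x₀ ξ S t).model w' + γ • (run F γ x₀ ξ S t).unsent w' := by
  induction t with
  | zero => rfl
  | succ t ih =>
    simp only [run_model_succ, run_unsent_succ, keep, smul_add, smul_sub] at ih ⊢
    linear_combination (norm := module) ih

lemma sum_norm_model_sub_average_sq_le (hn : 1 ≤ n) (t : ℕ) :
    ∑ w, ‖(run F γ x₀ ξ S t).model w - (run F γ x₀ ξ S t).average‖ ^ 2
      ≤ γ ^ 2 * ∑ w, ‖(run F γ x₀ ξ S t).unsent w‖ ^ 2 := by
  set s := run F γ x₀ ξ S t with hs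
  let w₀ : Fin n := ⟨0, hn⟩
  set c := s.model w₀ + γ • s.unsent w₀ with hc
  have h1 : ∀ w, s.model w = c - γ • s.unsent w := fun w =>
    eq_sub_of_add_eq (run_model_add_unsent F γ x₀ ξ S t w w₀)
  have h2 : ∀ w, s.model w - s.average
      = -(γ • (s.unsent w - (1 / (n : ℝ)) • ∑ w', s.unsent w')) := by
    intro w
    have h3 : s.average = c - γ • ((1 / (n : ℝ)) • ∑ w', s.unsent w') := by
      simp only [State.average, h1]
      rw [Finset.sum_sub_distrib, ← Finset.smul_sum, smul_sub, average_const hn, smul_comm]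
    rw [h3, h1 w, smul_sub]
    abel
  simp_rw [h2, norm_neg, norm_smul, mul_pow, Real.norm_eq_abs, sq_abs, ← Finset.mul_sum]
  exact mul_le_mul_of_nonneg_left (sum_norm_sub_average_sq_le hn _) (sq_nonneg γ)

end Dynamics

/-! ### Square-integrable random vectors -/

section SquareIntegrable

variable {Ω : Type*} {mΩ : MeasurableSpace Ω} {P : Measure Ω}
  {V : Type*} [NormedAddCommGroup V] [InnerProductSpace ℝ V]

lemma integrable_inner_of_memLp {u v : Ω → V} (hu : MemLp u 2 P) (hv : MemLp v 2 P) :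
    Integrable (fun ω => ⟪u ω, v ω⟫) P := by
  refine (hu.integrable_norm_pow two_ne_zero |>.add (hv.integrable_norm_pow two_ne_zero)).mono'
    (hu.1.inner hv.1) (Filter.Eventually.of_forall fun ω => ?_)
  refine (norm_inner_le_norm (𝕜 := ℝ) _ _).trans ?_
  simp only [Pi.add_apply]
  nlinarith [sq_nonneg (‖u ω‖ - ‖v ω‖), sq_nonneg ‖u ω‖, sq_nonneg ‖v ω‖]

lemma integral_norm_add_sq {u v : Ω → V} (hu : MemLp u 2 P) (hv : MemLp v 2 P) :
    ∫ ω, ‖u ω + v ω‖ ^ 2 ∂P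
      = ∫ ω, ‖u ω‖ ^ 2 ∂P + 2 * ∫ ω, ⟪u ω, v ω⟫ ∂P + ∫ ω, ‖v ω‖ ^ 2 ∂P := by
  have h1 := hu.integrable_norm_pow two_ne_zero
  have h2 := hv.integrable_norm_pow two_ne_zero
  have h3 := (integrable_inner_of_memLp hu hv).const_mul 2
  simp_rw [norm_add_sq_real]
  rw [integral_add (by exact h1.add h3) h2, integral_add h1 h3, integral_const_mul]

lemma integral_norm_sum_sq_of_orthogonal {ι : Type*} (s : Finset ι) {v : ι → Ω → V}
    (hv : ∀ i, MemLp (v i) 2 P) (ho : ∀ i j, i ≠ j → ∫ ω, ⟪v i ω, v j ω⟫ ∂P = 0) :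
    ∫ ω, ‖∑ i ∈ s, v i ω‖ ^ 2 ∂P = ∑ i ∈ s, ∫ ω, ‖v i ω‖ ^ 2 ∂P := by
  classical
  induction s using Finset.induction_on with
  | empty => simp
  | insert i s hi ih =>
    simp_rw [Finset.sum_insert hi]
    rw [integral_norm_add_sq (hv i) (memLp_finsetSum s fun j _ => hv j), ih]
    have h0 : ∫ ω, ⟪v i ω, ∑ j ∈ s, v j ω⟫ ∂P = 0 := by
      simp_rw [inner_sum]
      rw [integral_finsetSum s fun j _ => integrable_inner_of_memLp (hv i) (hv j)]
      exact Finset.sum_eq_zero fun j hj => ho i j (fun h => hi (h ▸ hj))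
    rw [h0, mul_zero, add_zero]

end SquareIntegrable

/-! ### Fresh samples -/

section Independence

variable {Ω : Type*} {mΩ : MeasurableSpace Ω} {P : Measure Ω} [IsProbabilityMeasure P]

lemma indepFun_prodMk_of_indepFun {α β γ : Type*} {mα : MeasurableSpace α}
    {mβ : MeasurableSpace β} {mγ : MeasurableSpace γ} {A : Ω → α} {B : Ω → β} {C : Ω → γ}
    (hA : Measurable A) (hB : Measurable B) (hC : Measurable C)
    (h : IndepFun A (fun ω => (B ω, C ω)) P) (hBC : IndepFun B C P) :
    IndepFun (fun ω => (A ω, B ω)) C P := by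
  have hAB : IndepFun A B P := h.comp measurable_id measurable_fst
  have : IsProbabilityMeasure (P.map A) := Measure.isProbabilityMeasure_map hA.aemeasurable
  have : IsProbabilityMeasure (P.map B) := Measure.isProbabilityMeasure_map hB.aemeasurable
  have : IsProbabilityMeasure (P.map C) := Measure.isProbabilityMeasure_map hC.aemeasurable
  have h1 := (indepFun_iff_map_prod_eq_prod_map_map hA.aemeasurable
    (hB.prodMk hC).aemeasurable).1 h
  have h2 := (indepFun_iff_map_prod_eq_prod_map_map hB.aemeasurable hC.aemeasurable).1 hBC
  have h3 := (indepFun_iff_map_prod_eq_prod_map_map hA.aemeasurable hB.aemeasurable).1 hAB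
  rw [indepFun_iff_map_prod_eq_prod_map_map (hA.prodMk hB).aemeasurable hC.aemeasurable, h3]
  apply (MeasurableEquiv.prodAssoc (α := α) (β := β) (γ := γ)).map_measurableEquiv_injective
  rw [Measure.prodAssoc_prod, ← h2, ← h1, Measure.map_map (MeasurableEquiv.measurable _)
    ((hA.prodMk hB).prodMk hC)]
  rfl

variable {d : ℕ} {Ξ : Type*} [MeasurableSpace Ξ] {D : Measure Ξ} [IsProbabilityMeasure D]
  {e : EuclideanSpace ℝ (Fin d) → Ξ → EuclideanSpace ℝ (Fin d)} {τ : ℝ}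

lemma memLp_and_integral_norm_sq_le
    (he : Measurable (Function.uncurry e))
    (hsq : ∀ x, Integrable (fun ζ => ‖e x ζ‖ ^ 2) D ∧ ∫ ζ, ‖e x ζ‖ ^ 2 ∂D ≤ τ)
    {X : Ω → EuclideanSpace ℝ (Fin d)} {ζ : Ω → Ξ} (hX : Measurable X) (hζ : Measurable ζ)
    (hlaw : P.map ζ = D) (hind : IndepFun X ζ P) :
    MemLp (fun ω => e (X ω) (ζ ω)) 2 P ∧ ∫ ω, ‖e (X ω) (ζ ω)‖ ^ 2 ∂P ≤ τ := by
  have : IsProbabilityMeasure (P.map X) := Measure.isProbabilityMeasure_map hX.aemeasurable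
  have hmap := (indepFun_iff_map_prod_eq_prod_map_map hX.aemeasurable hζ.aemeasurable).1 hind
  rw [hlaw] at hmap
  have hm : Measurable fun z : EuclideanSpace ℝ (Fin d) × Ξ => ‖e z.1 z.2‖ ^ 2 :=
    (he.norm.pow_const 2)
  have hmi : StronglyMeasurable fun x => ∫ ζ, ‖e x ζ‖ ^ 2 ∂D :=
    hm.stronglyMeasurable.integral_prod_right
  have hinner : Integrable (fun x => ∫ ζ, ‖e x ζ‖ ^ 2 ∂D) (P.map X) := by
    refine (integrable_const τ).mono' hmi.aestronglyMeasurable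
      (Filter.Eventually.of_forall fun x => ?_)
    rw [Real.norm_of_nonneg (integral_nonneg fun _ => by positivity)]
    exact (hsq x).2
  have hint : Integrable (fun z : EuclideanSpace ℝ (Fin d) × Ξ => ‖e z.1 z.2‖ ^ 2)
      ((P.map X).prod D) := by
    refine (integrable_prod_iff hm.aestronglyMeasurable).2
      ⟨Filter.Eventually.of_forall fun x => (hsq x).1, ?_⟩
    simpa using hinner
  have hXζ : Measurable fun ω => (X ω, ζ ω) := hX.prodMk hζ
  constructor
  · refine (memLp_two_iff_integrable_sq_norm (he.comp hXζ).aestronglyMeasurable).2 ?_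
    rw [← hmap] at hint
    exact hint.comp_measurable hXζ
  · calc ∫ ω, ‖e (X ω) (ζ ω)‖ ^ 2 ∂P
        = ∫ z, ‖e z.1 z.2‖ ^ 2 ∂((P.map X).prod D) := by
          rw [← hmap, integral_map hXζ.aemeasurable hm.aestronglyMeasurable]
      _ = ∫ x, ∫ ζ, ‖e x ζ‖ ^ 2 ∂D ∂(P.map X) := integral_prod _ hint
      _ ≤ ∫ _x, τ ∂(P.map X) :=
          integral_mono hinner (integrable_const τ) fun x => (hsq x).2
      _ = τ := by simp

/-- A centred function of a fresh sample is orthogonal to everything that is independent of the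
sample. -/
lemma integral_inner_eq_zero_of_indepFun
    (he : Measurable (Function.uncurry e)) (hint : ∀ x, Integrable (e x) D)
    (hmean : ∀ x, ∫ ζ, e x ζ ∂D = 0)
    {Y X : Ω → EuclideanSpace ℝ (Fin d)} {ζ : Ω → Ξ} (hY : Measurable Y) (hX : Measurable X)
    (hζ : Measurable ζ) (hlaw : P.map ζ = D) (hind : IndepFun (fun ω => (Y ω, X ω)) ζ P)
    (hYe : Integrable (fun ω => ⟪Y ω, e (X ω) (ζ ω)⟫) P) :
    ∫ ω, ⟪Y ω, e (X ω) (ζ ω)⟫ ∂P = 0 := by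
  have hYX : Measurable fun ω => (Y ω, X ω) := hY.prodMk hX
  have : IsProbabilityMeasure (P.map fun ω => (Y ω, X ω)) :=
    Measure.isProbabilityMeasure_map hYX.aemeasurable
  have hmap := (indepFun_iff_map_prod_eq_prod_map_map hYX.aemeasurable hζ.aemeasurable).1 hind
  rw [hlaw] at hmap
  have hm : Measurable fun z : (EuclideanSpace ℝ (Fin d) × EuclideanSpace ℝ (Fin d)) × Ξ =>
      ⟪z.1.1, e z.1.2 z.2⟫ :=
    (measurable_fst.comp measurable_fst).inner
      (he.comp ((measurable_snd.comp measurable_fst).prodMk measurable_snd))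
  have hprod : Integrable (fun z : (EuclideanSpace ℝ (Fin d) × EuclideanSpace ℝ (Fin d)) × Ξ =>
      ⟪z.1.1, e z.1.2 z.2⟫) ((P.map fun ω => (Y ω, X ω)).prod D) := by
    rw [← hmap, integrable_map_measure hm.aestronglyMeasurable (hYX.prodMk hζ).aemeasurable]
    exact hYe
  calc ∫ ω, ⟪Y ω, e (X ω) (ζ ω)⟫ ∂P
      = ∫ z, ⟪z.1.1, e z.1.2 z.2⟫ ∂((P.map fun ω => (Y ω, X ω)).prod D) := by
        rw [← hmap, integral_map (hYX.prodMk hζ).aemeasurable hm.aestronglyMeasurable]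
    _ = ∫ yx, ∫ ζ, ⟪yx.1, e yx.2 ζ⟫ ∂D ∂(P.map fun ω => (Y ω, X ω)) := integral_prod _ hprod
    _ = 0 := by simp [integral_inner (hint _), hmean]

/-- `ν` is noise of iteration `t`: it is known after iteration `t`, it is orthogonal to all square
integrable random vectors that are known before iteration `t` (so its conditional mean given the
past is zero), and its second moment is at most `τ`. -/
structure UnbiasedNoise {Ω : Type*} {mΩ : MeasurableSpace Ω} (P : Measure Ω) (ℱ : Filtration ℕ mΩ)
    {d : ℕ} (t : ℕ) (τ : ℝ) (ν : Ω → EuclideanSpace ℝ (Fin d)) : Prop where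
  measurable : Measurable[ℱ (t + 1)] ν
  memLp : MemLp ν 2 P
  orthogonal : ∀ Y : Ω → EuclideanSpace ℝ (Fin d), Measurable[ℱ t] Y → MemLp Y 2 P →
    ∫ ω, ⟪Y ω, ν ω⟫ ∂P = 0
  integral_norm_sq_le : ∫ ω, ‖ν ω‖ ^ 2 ∂P ≤ τ

/-- Averaging `e` over a set `T` of fresh samples, each evaluated at a point known before the
iteration, divides the variance by the number of samples. -/
lemma unbiasedNoise_average {ℱ : Filtration ℕ mΩ} {t : ℕ}
    (he : Measurable (Function.uncurry e)) (hmean : ∀ x, ∫ ζ, e x ζ ∂D = 0)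
    (hsq : ∀ x, Integrable (fun ζ => ‖e x ζ‖ ^ 2) D ∧ ∫ ζ, ‖e x ζ‖ ^ 2 ∂D ≤ τ)
    {ι : Type*} [Fintype ι] {ζ : ι → Ω → Ξ}
    (hζ : ∀ q, Measurable[ℱ (t + 1)] (ζ q)) (hlaw : ∀ q, P.map (ζ q) = D)
    (hind : iIndepFun ζ P)
    (hpast : Indep (MeasurableSpace.comap (fun ω q => ζ q ω) MeasurableSpace.pi) (ℱ t) P)
    {X : ι → Ω → EuclideanSpace ℝ (Fin d)} (hX : ∀ q, Measurable[ℱ t] (X q))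
    (T : Finset ι) (hT : T.Nonempty) :
    UnbiasedNoise P ℱ t (τ / T.card)
      (fun ω => (1 / (T.card : ℝ)) • ∑ q ∈ T, e (X q ω) (ζ q ω)) := by
  have hζ' : ∀ q, Measurable (ζ q) := fun q => (hζ q).mono (ℱ.le _) le_rfl
  have hX' : ∀ q, Measurable (X q) := fun q => (hX q).mono (ℱ.le _) le_rfl
  have hζall : Measurable fun ω q => ζ q ω := measurable_pi_lambda _ hζ'
  have hint : ∀ x, Integrable (e x) D := fun x =>
    ((memLp_two_iff_integrable_sq_norm
      (he.comp measurable_prodMk_left).aestronglyMeasurable).2 (hsq x).1).integrable one_le_two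
  have hindpast : ∀ {β : Type _} {mβ : MeasurableSpace β} (A : Ω → β), Measurable[ℱ t] A →
      IndepFun A (fun ω q => ζ q ω) P := fun A hA =>
    indep_of_indep_of_le_left hpast.symm hA.comap_le
  have hmem : ∀ q, MemLp (fun ω => e (X q ω) (ζ q ω)) 2 P ∧ ∫ ω, ‖e (X q ω) (ζ q ω)‖ ^ 2 ∂P ≤ τ :=
    fun q => memLp_and_integral_norm_sq_le he hsq (hX' q) (hζ' q) (hlaw q)
      ((hindpast _ (hX q)).comp measurable_id (measurable_pi_apply q))
  have hcross : ∀ q r, q ≠ r → ∫ ω, ⟪e (X q ω) (ζ q ω), e (X r ω) (ζ r ω)⟫ ∂P = 0 := by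
    intro q r hqr
    -- `ζ r` is independent of the past together with `ζ q`.
    have h1 : IndepFun (fun ω => ((X q ω, X r ω), ζ q ω)) (ζ r) P := by
      refine indepFun_prodMk_of_indepFun ((hX' q).prodMk (hX' r)) (hζ' q) (hζ' r) ?_
        (hind.indepFun hqr)
      exact (hindpast _ ((hX q).prodMk (hX r))).comp measurable_id
        ((measurable_pi_apply q).prodMk (measurable_pi_apply r))
    have hφ : Measurable fun z : (EuclideanSpace ℝ (Fin d) × EuclideanSpace ℝ (Fin d)) × Ξ =>
        (e z.1.1 z.2, z.1.2) :=
      (he.comp ((measurable_fst.comp measurable_fst).prodMk measurable_snd)).prodMk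
        (measurable_snd.comp measurable_fst)
    exact integral_inner_eq_zero_of_indepFun he hint hmean
      (he.comp ((hX' q).prodMk (hζ' q))) (hX' r) (hζ' r) (hlaw r)
      (h1.comp hφ measurable_id) (integrable_inner_of_memLp (hmem q).1 (hmem r).1)
  have hc : (0 : ℝ) < T.card := by exact_mod_cast hT.card_pos
  refine ⟨?_, ?_, ?_, ?_⟩
  · have hsum : Measurable[ℱ (t + 1)] fun ω => ∑ q ∈ T, e (X q ω) (ζ q ω) :=
      Finset.measurable_sum T fun q _ =>
        he.comp (((hX q).mono (ℱ.mono (Nat.le_succ t)) le_rfl).prodMk (hζ q))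
    exact hsum.const_smul (1 / (T.card : ℝ))
  · exact (memLp_finsetSum T fun q _ => (hmem q).1).const_smul (1 / (T.card : ℝ))
  · intro Y hY hY2
    simp_rw [inner_smul_right, inner_sum]
    rw [integral_const_mul, integral_finsetSum T fun q _ =>
      integrable_inner_of_memLp hY2 (hmem q).1, Finset.sum_eq_zero, mul_zero]
    intro q _
    exact integral_inner_eq_zero_of_indepFun he hint hmean (hY.mono (ℱ.le _) le_rfl) (hX' q)
      (hζ' q) (hlaw q)
      ((hindpast _ (hY.prodMk (hX q))).comp measurable_id (measurable_pi_apply q))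
      (integrable_inner_of_memLp hY2 (hmem q).1)
  · simp_rw [norm_smul, mul_pow]
    rw [integral_const_mul, integral_norm_sum_sq_of_orthogonal T (fun q => (hmem q).1) hcross,
      Real.norm_of_nonneg (by positivity)]
    calc (1 / (T.card : ℝ)) ^ 2 * ∑ q ∈ T, ∫ ω, ‖e (X q ω) (ζ q ω)‖ ^ 2 ∂P
        ≤ (1 / (T.card : ℝ)) ^ 2 * ∑ _q ∈ T, τ := by
          gcongr with q
          exact (hmem q).2
      _ = τ / T.card := by
          rw [Finset.sum_const, nsmul_eq_mul]
          field_simp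

end Independence

/-! ### Noise that stays pending -/

section Residual

variable {Ω : Type*} {mΩ : MeasurableSpace Ω} {P : Measure Ω} {ℱ : Filtration ℕ mΩ}
  {d y : ℕ} {grp : Fin d → Fin y}

lemma measurable_keep {m : MeasurableSpace Ω} {S : Ω → Selection grp}
    {v : Ω → EuclideanSpace ℝ (Fin d)} (hS : ∀ j, MeasurableSet {ω | Selected (S ω) j})
    (hv : Measurable v) : Measurable fun ω => keep (S ω) (v ω) := by
  classical
  refine (WithLp.measurable_toLp 2 (Fin d → ℝ)).comp (f := fun ω => (keep (S ω) (v ω)).ofLp)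
    (measurable_pi_lambda _ fun j => ?_)
  simp_rw [keep_apply]
  exact Measurable.ite (hS j) measurable_const
    ((measurable_pi_apply j).comp ((WithLp.measurable_ofLp 2 (Fin d → ℝ)).comp hv))

lemma memLp_keep {S : Ω → Selection grp}
    {v : Ω → EuclideanSpace ℝ (Fin d)} (hS : ∀ j, MeasurableSet {ω | Selected (S ω) j})
    (hv : Measurable v) (hv2 : MemLp v 2 P) : MemLp (fun ω => keep (S ω) (v ω)) 2 P :=
  hv2.mono (measurable_keep hS hv).aestronglyMeasurable
    (Filter.Eventually.of_forall fun _ => norm_keep_le _ _)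

/-- Pending noise has at most the second moment of all noise that has been accumulated: the
selection may be correlated with the noise of the same iteration, but since it only deletes
coordinates it cannot increase the norm, and the noise that survives is known before the next noise
arrives. So the second moments add up, as for a martingale. -/
lemma UnbiasedNoise.residual {S : ℕ → Ω → Selection grp}
    {ν : ℕ → Ω → EuclideanSpace ℝ (Fin d)} {τ : ℝ} (s m : ℕ)
    (hS : ∀ k < m, ∀ j, MeasurableSet[ℱ (s + k + 1)] {ω | Selected (S (s + k) ω) j})
    (hν : ∀ k < m, UnbiasedNoise P ℱ (s + k) τ (ν (s + k))) :
    Measurable[ℱ (s + m)] (fun ω => residual (fun t => S t ω) (fun t => ν t ω) s m) ∧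
    MemLp (fun ω => residual (fun t => S t ω) (fun t => ν t ω) s m) 2 P ∧
    ∫ ω, ‖residual (fun t => S t ω) (fun t => ν t ω) s m‖ ^ 2 ∂P ≤ m * τ := by
  induction m with
  | zero => simp [MergeComp.residual]
  | succ m ih =>
    obtain ⟨h1, h2, h3⟩ := ih (fun k hk => hS k (hk.trans (Nat.lt_succ_self m)))
      (fun k hk => hν k (hk.trans (Nat.lt_succ_self m)))
    have hνm := hν m (Nat.lt_succ_self m)
    have hSm := hS m (Nat.lt_succ_self m)
    have hm : Measurable[ℱ (s + m + 1)]
        (fun ω => MergeComp.residual (fun t => S t ω) (fun t => ν t ω) s m + ν (s + m) ω) :=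
      (h1.mono (ℱ.mono (Nat.le_succ _)) le_rfl).add hνm.measurable
    have hL2 := h2.add hνm.memLp
    have hk2 := memLp_keep (P := P) (fun j => ℱ.le _ _ (hSm j)) (hm.mono (ℱ.le _) le_rfl) hL2
    refine ⟨measurable_keep hSm hm, hk2, ?_⟩
    calc ∫ ω, ‖keep (S (s + m) ω)
            (MergeComp.residual (fun t => S t ω) (fun t => ν t ω) s m + ν (s + m) ω)‖ ^ 2 ∂P
        ≤ ∫ ω, ‖MergeComp.residual (fun t => S t ω) (fun t => ν t ω) s m
            + ν (s + m) ω‖ ^ 2 ∂P :=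
          integral_mono (hk2.integrable_norm_pow two_ne_zero) (hL2.integrable_norm_pow two_ne_zero)
            fun ω => pow_le_pow_left₀ (norm_nonneg _) (norm_keep_le _ _) 2
      _ ≤ m * τ + 2 * 0 + τ := by
          rw [integral_norm_add_sq h2 hνm.memLp, hνm.orthogonal _ h1 h2]
          gcongr
          exact hνm.integral_norm_sq_le
      _ = ((m + 1 : ℕ) : ℝ) * τ := by push_cast; ring

end Residual

/-! ### Measurability of stochastic gradients -/

lemma measurable_stochGrad {d : ℕ} {Ξ : Type*} [MeasurableSpace Ξ]
    {F : EuclideanSpace ℝ (Fin d) → Ξ → ℝ}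
    (hF : Measurable fun z : EuclideanSpace ℝ (Fin d) × Ξ => F z.1 z.2)
    (hdiff : ∀ ξ, Differentiable ℝ fun x => F x ξ) :
    Measurable fun z : EuclideanSpace ℝ (Fin d) × Ξ => stochGrad F z.1 z.2 := by
  refine (WithLp.measurable_toLp 2 (Fin d → ℝ)).comp
    (f := fun z : EuclideanSpace ℝ (Fin d) × Ξ => (stochGrad F z.1 z.2).ofLp)
    (measurable_pi_lambda _ fun j => ?_)
  set v : EuclideanSpace ℝ (Fin d) := EuclideanSpace.single j 1 with hv
  -- The partial derivatives are limits of difference quotients.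
  refine measurable_of_tendsto_metrizable (f := fun (k : ℕ) (z : EuclideanSpace ℝ (Fin d) × Ξ) =>
    (k : ℝ) • (F (z.1 + (k : ℝ)⁻¹ • v) z.2 - F z.1 z.2)) (fun k => ?_)
    (tendsto_pi_nhds.2 fun z => ?_)
  · have hshift : Measurable fun z : EuclideanSpace ℝ (Fin d) × Ξ =>
        F (z.1 + (k : ℝ)⁻¹ • v) z.2 :=
      hF.comp ((measurable_fst.add_const ((k : ℝ)⁻¹ • v)).prodMk measurable_snd)
    exact (hshift.sub hF).const_smul (k : ℝ)
  · have h1 := (hdiff z.2 z.1).hasGradientAt.hasFDerivAt.lim v (c := fun k : ℕ => (k : ℝ))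
      (l := Filter.atTop) (by simpa using tendsto_natCast_atTop_atTop)
    have h2 : ⟪gradient (fun x => F x z.2) z.1, v⟫ = (stochGrad F z.1 z.2).ofLp j := by
      rw [hv, EuclideanSpace.inner_single_right]
      simp [stochGrad]
    rw [← h2]
    simpa using h1

/-! ### Composition of a smooth loss with square-integrable random vectors -/

section Compositions

variable {Ω : Type*} {mΩ : MeasurableSpace Ω} {P : Measure Ω} [IsProbabilityMeasure P] {d : ℕ}
  {f : EuclideanSpace ℝ (Fin d) → ℝ} {L : ℝ}

lemma continuous_gradient (hL : ∀ x z, ‖gradient f x - gradient f z‖ ≤ L * ‖x - z‖) :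
    Continuous (gradient f) := by
  have : LipschitzWith L.toNNReal (gradient f) := LipschitzWith.of_dist_le_mul fun x z => by
    rw [dist_eq_norm, dist_eq_norm]
    exact (hL x z).trans (by gcongr; exact Real.le_coe_toNNReal L)
  exact this.continuous

lemma memLp_gradient_comp (hL : ∀ x z, ‖gradient f x - gradient f z‖ ≤ L * ‖x - z‖)
    {X : Ω → EuclideanSpace ℝ (Fin d)} (hX : MemLp X 2 P) :
    MemLp (fun ω => gradient f (X ω)) 2 P := by
  have h1 : MemLp (fun ω => gradient f (X ω) - gradient f 0) 2 P :=
    hX.of_le_mul (c := L) (((continuous_gradient hL).comp_aestronglyMeasurable hX.1).sub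
      aestronglyMeasurable_const) (Filter.Eventually.of_forall fun ω => by simpa using hL (X ω) 0)
  simpa [Pi.add_def] using h1.add (memLp_const (gradient f 0))

lemma integrable_smooth_comp (hf : Differentiable ℝ f)
    (hL : ∀ x z, ‖gradient f x - gradient f z‖ ≤ L * ‖x - z‖) {c : ℝ} (hc : ∀ x, c ≤ f x)
    {X : Ω → EuclideanSpace ℝ (Fin d)} (hX : MemLp X 2 P) : Integrable (fun ω => f (X ω)) P := by
  have hU : Integrable (fun ω => f 0 + ⟪gradient f 0, X ω⟫ + L / 2 * ‖X ω‖ ^ 2) P :=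
    ((integrable_const _).add ((hX.integrable one_le_two).const_inner _)).add
      ((hX.integrable_norm_pow two_ne_zero).const_mul _)
  refine (hU.abs.add (integrable_const |c|)).mono'
    (hf.continuous.comp_aestronglyMeasurable hX.1) (Filter.Eventually.of_forall fun ω => ?_)
  have h1 := descent_lemma hf hL 0 (X ω)
  rw [sub_zero] at h1
  rw [Real.norm_eq_abs, Pi.add_apply, abs_le]
  have h2 := le_abs_self (f 0 + ⟪gradient f 0, X ω⟫ + L / 2 * ‖X ω‖ ^ 2)
  have h3 := abs_nonneg (f 0 + ⟪gradient f 0, X ω⟫ + L / 2 * ‖X ω‖ ^ 2)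
  constructor <;> linarith [hc (X ω), neg_abs_le c, abs_nonneg c]

end Compositions

/-! ### Regularity of the random run -/

section RandomRun

variable {n d y b p K : ℕ} {Ξ : Type*} [MeasurableSpace Ξ] {Ω : Type*} {mΩ : MeasurableSpace Ω}
  {grp : Fin d → Fin y}

/-- The assumptions on the data, the samples and the selections, for workers that share the loss `F`
and the distribution `D`; here `f` is the expected loss. -/
structure SharedData (n b K : ℕ) (F : EuclideanSpace ℝ (Fin d) → Ξ → ℝ) (D : Measure Ξ)
    (f : EuclideanSpace ℝ (Fin d) → ℝ) (L σ : ℝ) (P : Measure Ω) (ℱ : Filtration ℕ mΩ)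
    (ξ : ℕ → Fin n → Fin b → Ω → Ξ) (S : ℕ → Fin n → Ω → Selection grp) : Prop where
  measurable_stochGrad : Measurable fun z : EuclideanSpace ℝ (Fin d) × Ξ => stochGrad F z.1 z.2
  differentiable : Differentiable ℝ f
  lipschitz : ∀ x z, ‖gradient f x - gradient f z‖ ≤ L * ‖x - z‖
  variance : ∀ x, Integrable (fun ζ => ‖stochGrad F x ζ - gradient f x‖ ^ 2) D ∧
    ∫ ζ, ‖stochGrad F x ζ - gradient f x‖ ^ 2 ∂D ≤ σ ^ 2
  unbiased : ∀ x, ∫ ζ, (stochGrad F x ζ - gradient f x) ∂D = 0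
  measurable_sample : ∀ t < K, ∀ w k, Measurable[ℱ (t + 1)] (ξ t w k)
  law : ∀ t < K, ∀ w k, P.map (ξ t w k) = D
  indep : ∀ t < K, iIndepFun (fun q : Fin n × Fin b => ξ t q.1 q.2) P
  indep_past : ∀ t < K, Indep
    (MeasurableSpace.comap (fun ω (q : Fin n × Fin b) => ξ t q.1 q.2 ω) MeasurableSpace.pi) (ℱ t) P
  measurable_selected : ∀ t < K, ∀ w j, MeasurableSet[ℱ (t + 1)] {ω | Selected (S t w ω) j}

/-- The run of workers that share the loss `F`, as a function of the random outcome. -/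
def randomRun (F : EuclideanSpace ℝ (Fin d) → Ξ → ℝ) (γ : ℝ) (x₀ : EuclideanSpace ℝ (Fin d))
    (ξ : ℕ → Fin n → Fin b → Ω → Ξ) (S : ℕ → Fin n → Ω → Selection grp) (t : ℕ) (ω : Ω) :
    State n d :=
  run (fun _ => F) γ x₀ (fun s w k => ξ s w k ω) (fun s w => S s w ω) t

/-- The mini-batch gradient of worker `w` in iteration `t`, as a function of the random outcome. -/
def randomGrad (F : EuclideanSpace ℝ (Fin d) → Ξ → ℝ) (γ : ℝ) (x₀ : EuclideanSpace ℝ (Fin d))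
    (ξ : ℕ → Fin n → Fin b → Ω → Ξ) (S : ℕ → Fin n → Ω → Selection grp) (t : ℕ) (w : Fin n)
    (ω : Ω) : EuclideanSpace ℝ (Fin d) :=
  runGrad (fun _ => F) γ x₀ (fun s w k => ξ s w k ω) (fun s w => S s w ω) t w

variable {F : EuclideanSpace ℝ (Fin d) → Ξ → ℝ} {D : Measure Ξ} [IsProbabilityMeasure D]
  {f : EuclideanSpace ℝ (Fin d) → ℝ} {L σ : ℝ} {P : Measure Ω} [IsProbabilityMeasure P]
  {ℱ : Filtration ℕ mΩ} {ξ : ℕ → Fin n → Fin b → Ω → Ξ} {S : ℕ → Fin n → Ω → Selection grp}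
  (γ : ℝ) (x₀ : EuclideanSpace ℝ (Fin d))

/-- The mini-batch gradients are unbiased given the past, and the noise of their mean over the
workers has the variance of a batch of `n * b` samples. -/
lemma SharedData.unbiasedNoise (h : SharedData n b K F D f L σ P ℱ ξ S) (hn : 1 ≤ n) (hb : 1 ≤ b)
    {t : ℕ} (ht : t < K) (hX : ∀ w, Measurable[ℱ t] fun ω => (randomRun F γ x₀ ξ S t ω).model w) :
    (∀ w, UnbiasedNoise P ℱ t (σ ^ 2 / b) fun ω =>
      randomGrad F γ x₀ ξ S t w ω - gradient f ((randomRun F γ x₀ ξ S t ω).model w)) ∧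
    UnbiasedNoise P ℱ t (σ ^ 2 / (n * b)) fun ω => (1 / (n : ℝ)) • ∑ w,
      (randomGrad F γ x₀ ξ S t w ω - gradient f ((randomRun F γ x₀ ξ S t ω).model w)) := by
  have he : Measurable (Function.uncurry fun x ζ => stochGrad F x ζ - gradient f x) :=
    h.measurable_stochGrad.sub ((continuous_gradient h.lipschitz).measurable.comp measurable_fst)
  have key := unbiasedNoise_average (P := P) (ℱ := ℱ) (t := t) he h.unbiased h.variance
    (ζ := fun q : Fin n × Fin b => ξ t q.1 q.2) (fun q => h.measurable_sample t ht q.1 q.2)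
    (fun q => h.law t ht q.1 q.2) (h.indep t ht) (h.indep_past t ht)
    (X := fun q ω => (randomRun F γ x₀ ξ S t ω).model q.1) (fun q => hX q.1)
  have hnoise : ∀ w ω, randomGrad F γ x₀ ξ S t w ω
        - gradient f ((randomRun F γ x₀ ξ S t ω).model w)
      = (1 / (b : ℝ)) • ∑ k, (stochGrad F ((randomRun F γ x₀ ξ S t ω).model w) (ξ t w k ω)
        - gradient f ((randomRun F γ x₀ ξ S t ω).model w)) := by
    intro w ω
    rw [Finset.sum_sub_distrib, smul_sub, average_const hb]
    rfl
  have hb0 : Nonempty (Fin b) := ⟨⟨0, hb⟩⟩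
  have hn0 : Nonempty (Fin n) := ⟨⟨0, hn⟩⟩
  constructor
  · intro w
    simp_rw [hnoise]
    simpa [Finset.sum_product] using
      key ({w} ×ˢ Finset.univ) ((Finset.singleton_nonempty w).product Finset.univ_nonempty)
  · simp_rw [hnoise]
    have h2 := key Finset.univ Finset.univ_nonempty
    rw [Finset.card_univ, Fintype.card_prod, Fintype.card_fin, Fintype.card_fin] at h2
    push_cast at h2
    convert h2 using 2 with ω
    rw [← Finset.smul_sum, smul_smul, Fintype.sum_prod_type]
    congr 1
    ring

/-- The local models and the unsent gradients are known before the iteration, and square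
integrable. -/
lemma SharedData.regular (h : SharedData n b K F D f L σ P ℱ ξ S) (hn : 1 ≤ n) (hb : 1 ≤ b)
    {t : ℕ} (ht : t ≤ K) (w : Fin n) :
    (Measurable[ℱ t] (fun ω => (randomRun F γ x₀ ξ S t ω).model w) ∧
      MemLp (fun ω => (randomRun F γ x₀ ξ S t ω).model w) 2 P) ∧
    (Measurable[ℱ t] (fun ω => (randomRun F γ x₀ ξ S t ω).unsent w) ∧
      MemLp (fun ω => (randomRun F γ x₀ ξ S t ω).unsent w) 2 P) := by
  induction t generalizing w with
  | zero => exact ⟨⟨measurable_const, memLp_const x₀⟩, measurable_const, memLp_const 0⟩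
  | succ t ih =>
    have ht' : t < K := ht
    have ih := ih ht'.le
    have hmono : ∀ {v : Ω → EuclideanSpace ℝ (Fin d)}, Measurable[ℱ t] v →
        Measurable[ℱ (t + 1)] v :=
      fun hv => hv.mono (ℱ.mono (Nat.le_succ t)) le_rfl
    have hgrad : ∀ w, Measurable[ℱ (t + 1)] (randomGrad F γ x₀ ξ S t w) ∧
        MemLp (randomGrad F γ x₀ ξ S t w) 2 P := by
      intro w
      have hν := (h.unbiasedNoise γ x₀ hn hb ht' fun w => (ih w).1.1).1 w
      constructor
      · have h1 := hν.measurable.add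
          ((continuous_gradient h.lipschitz).measurable.comp (hmono (ih w).1.1))
        refine (funext fun ω => ?_ : randomGrad F γ x₀ ξ S t w = _) ▸ h1
        simp
      · have h1 := hν.memLp.add (memLp_gradient_comp h.lipschitz (ih w).1.2)
        refine (funext fun ω => ?_ : randomGrad F γ x₀ ξ S t w = _) ▸ h1
        simp
    have hkeep : ∀ w, Measurable[ℱ (t + 1)] (fun ω => keep (S t w ω)
          ((randomRun F γ x₀ ξ S t ω).unsent w + randomGrad F γ x₀ ξ S t w ω)) ∧
        MemLp (fun ω => keep (S t w ω)
          ((randomRun F γ x₀ ξ S t ω).unsent w + randomGrad F γ x₀ ξ S t w ω)) 2 P := by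
      intro w
      have hm : Measurable[ℱ (t + 1)] fun ω =>
          (randomRun F γ x₀ ξ S t ω).unsent w + randomGrad F γ x₀ ξ S t w ω :=
        (hmono (ih w).2.1).add (hgrad w).1
      exact ⟨measurable_keep (h.measurable_selected t ht' w) hm,
        memLp_keep (fun j => ℱ.le _ _ (h.measurable_selected t ht' w j)) (hm.mono (ℱ.le _) le_rfl)
          ((ih w).2.2.add (hgrad w).2)⟩
    have hsent : ∀ w, Measurable[ℱ (t + 1)] (fun ω => sparsify (S t w ω)
          ((randomRun F γ x₀ ξ S t ω).unsent w + randomGrad F γ x₀ ξ S t w ω)) ∧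
        MemLp (fun ω => sparsify (S t w ω)
          ((randomRun F γ x₀ ξ S t ω).unsent w + randomGrad F γ x₀ ξ S t w ω)) 2 P := by
      intro w
      have hs : ∀ ω, sparsify (S t w ω)
            ((randomRun F γ x₀ ξ S t ω).unsent w + randomGrad F γ x₀ ξ S t w ω)
          = (randomRun F γ x₀ ξ S t ω).unsent w + randomGrad F γ x₀ ξ S t w ω - keep (S t w ω)
            ((randomRun F γ x₀ ξ S t ω).unsent w + randomGrad F γ x₀ ξ S t w ω) :=
        fun ω => by rw [keep, sub_sub_cancel]
      simp_rw [hs]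
      exact ⟨((hmono (ih w).2.1).add (hgrad w).1).sub (hkeep w).1,
        ((ih w).2.2.add (hgrad w).2).sub (hkeep w).2⟩
    have hagg : Measurable[ℱ (t + 1)] (fun ω => ∑ w, sparsify (S t w ω)
        ((randomRun F γ x₀ ξ S t ω).unsent w + randomGrad F γ x₀ ξ S t w ω)) :=
      Finset.measurable_sum _ fun w _ => (hsent w).1
    refine ⟨⟨?_, ?_⟩, hkeep w⟩
    · exact (hmono (ih w).1.1).sub ((((hgrad w).1.sub (hsent w).1).add
        (hagg.const_smul (1 / (n : ℝ)))).const_smul γ)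
    · exact (ih w).1.2.sub ((((hgrad w).2.sub (hsent w).2).add
        ((memLp_finsetSum _ fun w _ => (hsent w).2).const_smul (1 / (n : ℝ)))).const_smul γ)

lemma SharedData.average_regular (h : SharedData n b K F D f L σ P ℱ ξ S) (hn : 1 ≤ n)
    (hb : 1 ≤ b) {t : ℕ} (ht : t ≤ K) :
    Measurable[ℱ t] (fun ω => (randomRun F γ x₀ ξ S t ω).average) ∧
      MemLp (fun ω => (randomRun F γ x₀ ξ S t ω).average) 2 P := by
  have hr := fun w => (h.regular γ x₀ hn hb ht w).1
  have hsum : Measurable[ℱ t] (fun ω => ∑ w, (randomRun F γ x₀ ξ S t ω).model w) :=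
    Finset.measurable_sum _ fun w _ => (hr w).1
  exact ⟨hsum.const_smul (1 / (n : ℝ)),
    (memLp_finsetSum _ fun w _ => (hr w).2).const_smul (1 / (n : ℝ))⟩

/-! ### Descent and consensus in expectation -/

/-- The squared deviation of the local models from their average, summed over the workers. -/
def deviation (s : State n d) : ℝ := ∑ w, ‖s.model w - s.average‖ ^ 2

lemma SharedData.integrable_gradient_average (h : SharedData n b K F D f L σ P ℱ ξ S)
    (hn : 1 ≤ n) (hb : 1 ≤ b) {t : ℕ} (ht : t ≤ K) :
    Integrable (fun ω => ‖gradient f (randomRun F γ x₀ ξ S t ω).average‖ ^ 2) P :=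
  (memLp_gradient_comp h.lipschitz (h.average_regular γ x₀ hn hb ht).2).integrable_norm_pow
    two_ne_zero

lemma SharedData.integrable_deviation (h : SharedData n b K F D f L σ P ℱ ξ S)
    (hn : 1 ≤ n) (hb : 1 ≤ b) {t : ℕ} (ht : t ≤ K) :
    Integrable (fun ω => deviation (randomRun F γ x₀ ξ S t ω)) P :=
  integrable_finsetSum _ fun w _ => ((h.regular γ x₀ hn hb ht w).1.2.sub
    (h.average_regular γ x₀ hn hb ht).2).integrable_norm_pow two_ne_zero

/-- The expected loss at the average of the local models decreases as in SGD with a mini-batch of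
`n * b` samples, up to the deviation of the local models, at which the gradients are computed. -/
lemma SharedData.descent (h : SharedData n b K F D f L σ P ℱ ξ S) (hn : 1 ≤ n) (hb : 1 ≤ b)
    (hL : 0 ≤ L) (hγ : 0 ≤ γ) (hLγ : L * γ ≤ 1) {c : ℝ} (hc : ∀ x, c ≤ f x) {t : ℕ} (ht : t < K) :
    ∫ ω, f (randomRun F γ x₀ ξ S (t + 1) ω).average ∂P
      ≤ ∫ ω, f (randomRun F γ x₀ ξ S t ω).average ∂P
        - γ / 2 * ∫ ω, ‖gradient f (randomRun F γ x₀ ξ S t ω).average‖ ^ 2 ∂P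
        + γ / 2 * (L ^ 2 / n * ∫ ω, deviation (randomRun F γ x₀ ξ S t ω) ∂P)
        + L * γ ^ 2 / 2 * (σ ^ 2 / (n * b)) := by
  set a : Ω → EuclideanSpace ℝ (Fin d) := fun ω => (randomRun F γ x₀ ξ S t ω).average with ha
  set x : Fin n → Ω → EuclideanSpace ℝ (Fin d) :=
    fun w ω => (randomRun F γ x₀ ξ S t ω).model w with hx
  set N : Ω → EuclideanSpace ℝ (Fin d) := fun ω => (1 / (n : ℝ)) • ∑ w,
    (randomGrad F γ x₀ ξ S t w ω - gradient f (x w ω)) with hN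
  set g : Ω → EuclideanSpace ℝ (Fin d) := fun ω => (1 / (n : ℝ)) • ∑ w, gradient f (x w ω) with hg
  set Y : Ω → EuclideanSpace ℝ (Fin d) := fun ω =>
    (-γ) • gradient f (a ω) + (L * γ ^ 2) • g ω with hY
  have hr := fun w => (h.regular γ x₀ hn hb ht.le w).1
  have hra := h.average_regular γ x₀ hn hb ht.le
  have hνN : UnbiasedNoise P ℱ t (σ ^ 2 / (n * b)) N :=
    (h.unbiasedNoise γ x₀ hn hb ht fun w => (hr w).1).2
  have hgc := (continuous_gradient h.lipschitz).measurable
  have hgsum : Measurable[ℱ t] fun ω => ∑ w, gradient f (x w ω) :=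
    Finset.measurable_sum _ fun w _ => hgc.comp (hr w).1
  have hYm : Measurable[ℱ t] Y :=
    ((hgc.comp hra.1).const_smul (-γ)).add
      ((hgsum.const_smul (1 / (n : ℝ))).const_smul (L * γ ^ 2))
  have hY2 : MemLp Y 2 P :=
    ((memLp_gradient_comp h.lipschitz hra.2).const_smul (-γ)).add
      (((memLp_finsetSum _ fun w _ => memLp_gradient_comp h.lipschitz (hr w).2).const_smul
        (1 / (n : ℝ))).const_smul (L * γ ^ 2))
  have hpt : ∀ ω, f (randomRun F γ x₀ ξ S (t + 1) ω).average ≤ f (a ω)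
      - γ / 2 * ‖gradient f (a ω)‖ ^ 2
      + γ / 2 * (L ^ 2 / n * deviation (randomRun F γ x₀ ξ S t ω))
      + L * γ ^ 2 / 2 * ‖N ω‖ ^ 2 + ⟪Y ω, N ω⟫ := by
    intro ω
    have hstep : (randomRun F γ x₀ ξ S (t + 1) ω).average = a ω - γ • (g ω + N ω) := by
      have h1 : g ω + N ω = (1 / (n : ℝ)) • ∑ w, randomGrad F γ x₀ ξ S t w ω := by
        rw [hg, hN]
        simp only
        rw [← smul_add, ← Finset.sum_add_distrib]
        simp
      rw [h1]
      exact run_average_succ _ γ x₀ _ _ hn t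
    have h1 := descent_lemma h.differentiable h.lipschitz (a ω) (a ω - γ • (g ω + N ω))
    rw [sub_sub_cancel_left, inner_neg_right, norm_neg, norm_smul, mul_pow, Real.norm_eq_abs,
      sq_abs, real_inner_smul_right, inner_add_right, norm_add_sq_real] at h1
    have h2 : ‖gradient f (a ω) - g ω‖ ^ 2 ≤ L ^ 2 / n * deviation (randomRun F γ x₀ ξ S t ω) := by
      have h3 : gradient f (a ω) - g ω
          = (1 / (n : ℝ)) • ∑ w, (gradient f (a ω) - gradient f (x w ω)) := by
        rw [Finset.sum_sub_distrib, smul_sub, average_const hn]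
      rw [h3]
      refine (norm_average_sq_le hn fun w => gradient f (a ω) - gradient f (x w ω)).trans ?_
      calc (1 / (n : ℝ)) * ∑ w, ‖gradient f (a ω) - gradient f (x w ω)‖ ^ 2
          ≤ (1 / (n : ℝ)) * ∑ w, (L * ‖x w ω - a ω‖) ^ 2 := by
            gcongr with w
            rw [norm_sub_rev]
            exact h.lipschitz _ _
        _ = L ^ 2 / n * deviation (randomRun F γ x₀ ξ S t ω) := by
            simp_rw [mul_pow]
            rw [← Finset.mul_sum, deviation]
            ring
    rw [norm_sub_sq_real] at h2
    have h4 : ⟪Y ω, N ω⟫ = -γ * ⟪gradient f (a ω), N ω⟫ + L * γ ^ 2 * ⟪g ω, N ω⟫ := by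
      rw [hY]
      simp only
      rw [inner_add_left, real_inner_smul_left, real_inner_smul_left]
    rw [hstep, h4]
    -- Since `L * γ ≤ 1`, the squared norm of the mean gradient has a nonpositive coefficient.
    have h5 : L * γ ^ 2 * ‖g ω‖ ^ 2 ≤ γ * ‖g ω‖ ^ 2 :=
      mul_le_mul_of_nonneg_right (by nlinarith) (by positivity)
    have h6 := mul_le_mul_of_nonneg_left h2 (by positivity : 0 ≤ γ / 2)
    nlinarith
  have hf0 := integrable_smooth_comp h.differentiable h.lipschitz hc hra.2
  have hf1 := integrable_smooth_comp h.differentiable h.lipschitz hc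
    (h.average_regular γ x₀ hn hb (Nat.succ_le_of_lt ht)).2
  have i1 := (h.integrable_gradient_average γ x₀ hn hb ht.le).const_mul (γ / 2)
  have i2 := ((h.integrable_deviation γ x₀ hn hb ht.le).const_mul (L ^ 2 / n)).const_mul (γ / 2)
  have i3 := (hνN.memLp.integrable_norm_pow two_ne_zero).const_mul (L * γ ^ 2 / 2)
  have i4 := integrable_inner_of_memLp hY2 hνN.memLp
  calc ∫ ω, f (randomRun F γ x₀ ξ S (t + 1) ω).average ∂P
      ≤ ∫ ω, (f (a ω) - γ / 2 * ‖gradient f (a ω)‖ ^ 2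
          + γ / 2 * (L ^ 2 / n * deviation (randomRun F γ x₀ ξ S t ω))
          + L * γ ^ 2 / 2 * ‖N ω‖ ^ 2 + ⟪Y ω, N ω⟫) ∂P :=
        integral_mono hf1 ((((hf0.sub i1).add i2).add i3).add i4) hpt
    _ = ∫ ω, f (a ω) ∂P - γ / 2 * ∫ ω, ‖gradient f (a ω)‖ ^ 2 ∂P
          + γ / 2 * (L ^ 2 / n * ∫ ω, deviation (randomRun F γ x₀ ξ S t ω) ∂P)
          + L * γ ^ 2 / 2 * ∫ ω, ‖N ω‖ ^ 2 ∂P + ∫ ω, ⟪Y ω, N ω⟫ ∂P := by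
        rw [integral_add (by exact ((hf0.sub i1).add i2).add i3) i4,
          integral_add (by exact (hf0.sub i1).add i2) i3, integral_add (by exact hf0.sub i1) i2,
          integral_sub hf0 i1, integral_const_mul, integral_const_mul, integral_const_mul,
          integral_const_mul]
    _ ≤ _ := by
        rw [hνN.orthogonal Y hYm hY2, add_zero]
        have := mul_le_mul_of_nonneg_left hνN.integral_norm_sq_le
          (by positivity : 0 ≤ L * γ ^ 2 / 2)
        linarith

/-- The deviation of the local models is caused by the gradients of the last `p` iterations: their
noise contributes additively, and their means with a factor `p`. -/
lemma SharedData.consensus (h : SharedData n b K F D f L σ P ℱ ξ S) (hn : 1 ≤ n) (hb : 1 ≤ b)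
    (hS : ∀ᵐ ω ∂P, ∀ t, t + p ≤ K → ∀ w j,
      ∃ s, t ≤ s ∧ s < t + p ∧ Selected (S s w ω) j)
    {t : ℕ} (ht : t < K) :
    ∫ ω, deviation (randomRun F γ x₀ ξ S t ω) ∂P
      ≤ 2 * n * p * γ ^ 2 * σ ^ 2 / b
        + 4 * p * γ ^ 2 * ∑ k ∈ Finset.Ico (t - p) t,
          (n * ∫ ω, ‖gradient f (randomRun F γ x₀ ξ S k ω).average‖ ^ 2 ∂P
            + L ^ 2 * ∫ ω, deviation (randomRun F γ x₀ ξ S k ω) ∂P) := by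
  set x : ℕ → Fin n → Ω → EuclideanSpace ℝ (Fin d) :=
    fun s w ω => (randomRun F γ x₀ ξ S s ω).model w with hx
  set ν : Fin n → ℕ → Ω → EuclideanSpace ℝ (Fin d) := fun w s ω =>
    randomGrad F γ x₀ ξ S s w ω - gradient f (x s w ω) with hν
  set R : Fin n → Ω → EuclideanSpace ℝ (Fin d) := fun w ω =>
    residual (fun s => S s w ω) (fun s => ν w s ω) (t - p) (t - (t - p)) with hR
  have hlt : ∀ k < t - (t - p), t - p + k < K := fun k hk => by omega
  have hmp : ((t - (t - p) : ℕ) : ℝ) ≤ p := by exact_mod_cast (by omega : t - (t - p) ≤ p)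
  have hres : ∀ w, MemLp (R w) 2 P ∧ ∫ ω, ‖R w ω‖ ^ 2 ∂P ≤ p * (σ ^ 2 / b) := by
    intro w
    have h1 := UnbiasedNoise.residual (P := P) (ℱ := ℱ) (S := fun s => S s w) (ν := ν w)
      (τ := σ ^ 2 / b) (t - p) (t - (t - p))
      (fun k hk j => h.measurable_selected _ (hlt k hk) w j)
      (fun k hk => (h.unbiasedNoise γ x₀ hn hb (hlt k hk)
        fun w => (h.regular γ x₀ hn hb (hlt k hk).le w).1.1).1 w)
    exact ⟨h1.2.1, h1.2.2.trans (by gcongr)⟩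
  have hgradsum : ∀ k ω, ∑ w, ‖gradient f (x k w ω)‖ ^ 2
      ≤ 2 * (n * ‖gradient f (randomRun F γ x₀ ξ S k ω).average‖ ^ 2
        + L ^ 2 * deviation (randomRun F γ x₀ ξ S k ω)) := by
    intro k ω
    have h1 : ∀ w, ‖gradient f (x k w ω)‖ ^ 2
        ≤ 2 * ‖gradient f (randomRun F γ x₀ ξ S k ω).average‖ ^ 2
          + 2 * (L ^ 2 * ‖x k w ω - (randomRun F γ x₀ ξ S k ω).average‖ ^ 2) := by
      intro w
      have h2 := norm_add_sq_le_two (gradient f (randomRun F γ x₀ ξ S k ω).average)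
        (gradient f (x k w ω) - gradient f (randomRun F γ x₀ ξ S k ω).average)
      rw [add_sub_cancel] at h2
      refine h2.trans (by
        gcongr
        rw [← mul_pow]
        exact pow_le_pow_left₀ (norm_nonneg _) (h.lipschitz _ _) 2)
    refine (Finset.sum_le_sum fun w _ => h1 w).trans (le_of_eq ?_)
    rw [Finset.sum_add_distrib, ← Finset.mul_sum, ← Finset.mul_sum, ← Finset.mul_sum, deviation,
      Finset.sum_const, Finset.card_univ, Fintype.card_fin, nsmul_eq_mul]
    ring
  have hpt : ∀ᵐ ω ∂P, deviation (randomRun F γ x₀ ξ S t ω)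
      ≤ γ ^ 2 * (2 * ∑ w, ‖R w ω‖ ^ 2 + 4 * p * ∑ k ∈ Finset.Ico (t - p) t,
          (n * ‖gradient f (randomRun F γ x₀ ξ S k ω).average‖ ^ 2
            + L ^ 2 * deviation (randomRun F γ x₀ ξ S k ω))) := by
    filter_upwards [hS] with ω hω
    refine (sum_norm_model_sub_average_sq_le _ γ x₀ _ _ hn t).trans
      (mul_le_mul_of_nonneg_left ?_ (sq_nonneg γ))
    have h1 : ∀ w, (randomRun F γ x₀ ξ S t ω).unsent w
        = R w ω + residual (fun s => S s w ω) (fun s => gradient f (x s w ω))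
          (t - p) (t - (t - p)) := by
      intro w
      rw [hR]
      simp only
      rw [← residual_add]
      simp only [hν, sub_add_cancel]
      rw [← residual_eq_window]
      · exact run_unsent_eq_residual _ γ x₀ _ _ t w
      · intro hpt j
        obtain ⟨s, hs1, hs2, hs3⟩ := hω (t - p) (by omega) w j
        exact ⟨s, hs1, by omega, hs3⟩
    have h2 : ∀ w, ‖(randomRun F γ x₀ ξ S t ω).unsent w‖ ^ 2 ≤ 2 * ‖R w ω‖ ^ 2
        + 2 * (p * ∑ k ∈ Finset.Ico (t - p) t, ‖gradient f (x k w ω)‖ ^ 2) := by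
      intro w
      rw [h1 w, Finset.sum_Ico_eq_sum_range]
      refine (norm_add_sq_le_two _ _).trans ?_
      gcongr
      exact (norm_residual_sq_le _ _ _ _).trans (by gcongr)
    calc ∑ w, ‖(randomRun F γ x₀ ξ S t ω).unsent w‖ ^ 2
        ≤ ∑ w, (2 * ‖R w ω‖ ^ 2
          + 2 * (p * ∑ k ∈ Finset.Ico (t - p) t, ‖gradient f (x k w ω)‖ ^ 2)) :=
          Finset.sum_le_sum fun w _ => h2 w
      _ = 2 * ∑ w, ‖R w ω‖ ^ 2
          + 2 * p * ∑ k ∈ Finset.Ico (t - p) t, ∑ w, ‖gradient f (x k w ω)‖ ^ 2 := by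
          rw [Finset.sum_add_distrib, ← Finset.mul_sum, ← Finset.mul_sum, ← Finset.mul_sum,
            Finset.sum_comm, mul_assoc]
      _ ≤ 2 * ∑ w, ‖R w ω‖ ^ 2 + 2 * p * ∑ k ∈ Finset.Ico (t - p) t,
          2 * (n * ‖gradient f (randomRun F γ x₀ ξ S k ω).average‖ ^ 2
            + L ^ 2 * deviation (randomRun F γ x₀ ξ S k ω)) := by
          gcongr with k _
          exact hgradsum k ω
      _ = _ := by rw [← Finset.mul_sum]; ring
  have i1 : Integrable (fun ω => 2 * ∑ w, ‖R w ω‖ ^ 2) P :=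
    (integrable_finsetSum _ fun w _ => (hres w).1.integrable_norm_pow two_ne_zero).const_mul 2
  have i2 : ∀ k ∈ Finset.Ico (t - p) t, Integrable (fun ω =>
      n * ‖gradient f (randomRun F γ x₀ ξ S k ω).average‖ ^ 2
        + L ^ 2 * deviation (randomRun F γ x₀ ξ S k ω)) P := fun k hk =>
    have hk : k ≤ K := ((Finset.mem_Ico.1 hk).2.trans ht).le
    ((h.integrable_gradient_average γ x₀ hn hb hk).const_mul _).add
      ((h.integrable_deviation γ x₀ hn hb hk).const_mul _)
  have i3 := (integrable_finsetSum _ i2).const_mul (4 * (p : ℝ))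
  refine (integral_mono_ae (h.integrable_deviation γ x₀ hn hb ht.le)
    ((i1.add i3).const_mul (γ ^ 2)) hpt).trans ?_
  rw [integral_const_mul]
  simp only [Pi.add_apply]
  rw [integral_add i1 i3, integral_const_mul, integral_const_mul,
    integral_finsetSum _ fun w _ => (hres w).1.integrable_norm_pow two_ne_zero,
    integral_finsetSum _ i2]
  have h3 : ∑ k ∈ Finset.Ico (t - p) t, ∫ ω,
        (n * ‖gradient f (randomRun F γ x₀ ξ S k ω).average‖ ^ 2
          + L ^ 2 * deviation (randomRun F γ x₀ ξ S k ω)) ∂P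
      = ∑ k ∈ Finset.Ico (t - p) t,
        (n * ∫ ω, ‖gradient f (randomRun F γ x₀ ξ S k ω).average‖ ^ 2 ∂P
          + L ^ 2 * ∫ ω, deviation (randomRun F γ x₀ ξ S k ω) ∂P) := by
    refine Finset.sum_congr rfl fun k hk => ?_
    have hk : k ≤ K := ((Finset.mem_Ico.1 hk).2.trans ht).le
    rw [integral_add ((h.integrable_gradient_average γ x₀ hn hb hk).const_mul _)
      ((h.integrable_deviation γ x₀ hn hb hk).const_mul _), integral_const_mul,
      integral_const_mul]
  rw [h3]
  have h4 : ∑ w, ∫ ω, ‖R w ω‖ ^ 2 ∂P ≤ n * (p * (σ ^ 2 / b)) := by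
    refine (Finset.sum_le_sum fun w _ => (hres w).2).trans (le_of_eq ?_)
    simp
  have h5 := mul_le_mul_of_nonneg_left h4 (by positivity : 0 ≤ γ ^ 2 * 2)
  have h6 : γ ^ 2 * 2 * (n * (p * (σ ^ 2 / b))) = 2 * n * p * γ ^ 2 * σ ^ 2 / b := by ring
  linarith

end RandomRun

/-! ### Summation over the iterations -/

/-- Each summand occurs in at most `p` of the windows. -/
lemma sum_sum_window_le {u : ℕ → ℝ} (hu : ∀ k, 0 ≤ u k) (p K : ℕ) :
    ∑ t ∈ Finset.range K, ∑ k ∈ Finset.Ico (t - p) t, u k ≤ p * ∑ k ∈ Finset.range K, u k := by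
  rw [Finset.sum_comm' (t' := Finset.range K)
    (s' := fun k => (Finset.range K).filter fun t => k ∈ Finset.Ico (t - p) t), Finset.mul_sum]
  · refine Finset.sum_le_sum fun k _ => ?_
    rw [Finset.sum_const, nsmul_eq_mul]
    refine mul_le_mul_of_nonneg_right ?_ (hu k)
    have h1 : (Finset.range K).filter (fun t => k ∈ Finset.Ico (t - p) t)
        ⊆ Finset.Ioc k (k + p) := by
      intro t ht
      simp only [Finset.mem_filter, Finset.mem_range, Finset.mem_Ico, Finset.mem_Ioc] at ht ⊢
      omega
    have h2 := Finset.card_le_card h1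
    rw [Nat.card_Ioc, Nat.add_sub_cancel_left] at h2
    exact_mod_cast h2
  · intro t k
    simp only [Finset.mem_filter, Finset.mem_range, Finset.mem_Ico]
    omega

/-- Descent inequalities for the values `φ t`, coupled with a consensus inequality for `v t`, bound
the sum of `G t`. A single worker never deviates; for at least two workers the step size bound makes
the contribution of `G` to `v` so small that the descent absorbs it. -/
lemma sum_le_of_descent_of_consensus {n p K : ℕ} {φ G v : ℕ → ℝ} {γ q c X B : ℝ}
    (hγ : 0 < γ) (hB : 0 ≤ B) (hX : 0 ≤ X) (hG : ∀ t, 0 ≤ G t) (hv : ∀ t, 0 ≤ v t)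
    (hq : 0 ≤ q) (hqn : 12 * n * (p : ℝ) ^ 2 * q ≤ 1) (hn : 1 ≤ n) (hc : c ≤ φ K) (hc0 : c ≤ φ 0)
    (hdesc : ∀ t < K, φ (t + 1) ≤ φ t - γ / 2 * G t + γ / 2 * v t + γ / 2 * B)
    (hone : n = 1 → ∀ t, v t = 0)
    (hcons : ∀ t < K, v t ≤ 2 * X + 4 * p * q * ∑ k ∈ Finset.Ico (t - p) t, (G k + v k)) :
    ∑ t ∈ Finset.range K, G t ≤ 2 * (2 * (φ 0 - c) / γ + K * B) + 2 * n * K * X := by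
  set SG := ∑ t ∈ Finset.range K, G t with hSG
  set SV := ∑ t ∈ Finset.range K, v t with hSV
  have hSG0 : 0 ≤ SG := Finset.sum_nonneg fun t _ => hG t
  have hSV0 : 0 ≤ SV := Finset.sum_nonneg fun t _ => hv t
  have h1 : SG ≤ 2 * (φ 0 - c) / γ + SV + K * B := by
    have h2 : ∑ t ∈ Finset.range K, (φ (t + 1) - φ t)
        ≤ ∑ t ∈ Finset.range K, (-(γ / 2) * G t + γ / 2 * v t + γ / 2 * B) :=
      Finset.sum_le_sum fun t ht => by linarith [hdesc t (Finset.mem_range.1 ht)]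
    rw [Finset.sum_range_sub, Finset.sum_add_distrib, Finset.sum_add_distrib, ← Finset.mul_sum,
      ← Finset.mul_sum, Finset.sum_const, Finset.card_range, nsmul_eq_mul, ← hSG, ← hSV] at h2
    have h3 : γ * (SG - SV - K * B) ≤ 2 * (φ 0 - c) := by linarith
    have h4 : SG - SV - K * B ≤ 2 * (φ 0 - c) / γ := by
      rw [le_div_iff₀ hγ]
      linarith
    linarith
  have hD : 0 ≤ 2 * (φ 0 - c) / γ := div_nonneg (by linarith) hγ.le
  have hKB : 0 ≤ K * B := by positivity
  have hKX : 0 ≤ K * X := by positivity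
  rcases hn.eq_or_lt with h | h
  · have h2 : SV = 0 := Finset.sum_eq_zero fun t _ => hone h.symm t
    have h3 : 0 ≤ 2 * (n : ℝ) * K * X := by positivity
    linarith
  · have hn2 : (2 : ℝ) ≤ n := by exact_mod_cast h
    have h2 : SV ≤ 2 * (K * X) + 4 * (p : ℝ) ^ 2 * q * (SG + SV) := by
      have h3 := Finset.sum_le_sum fun t ht => hcons t (Finset.mem_range.1 ht)
      rw [Finset.sum_add_distrib, ← Finset.mul_sum, Finset.sum_const, Finset.card_range,
        nsmul_eq_mul, ← hSV, ← Finset.mul_sum] at h3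
      have h4 := mul_le_mul_of_nonneg_left
        (sum_sum_window_le (fun k => add_nonneg (hG k) (hv k)) p K)
        (by positivity : 0 ≤ 4 * (p : ℝ) * q)
      rw [Finset.sum_add_distrib (s := Finset.range K), ← hSG, ← hSV] at h4
      linarith
    have h5 : 4 * (p : ℝ) ^ 2 * q ≤ 1 / 6 := by
      have : 0 ≤ (p : ℝ) ^ 2 * q := by positivity
      nlinarith
    have h6 := mul_le_mul_of_nonneg_right h5 (add_nonneg hSG0 hSV0)
    have h7 : 4 * (K * X) ≤ 2 * n * K * X := by nlinarith
    linarith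

/-! ### The convergence bound -/

variable {n d y b p K : ℕ} {Ξ : Type*} [MeasurableSpace Ξ] {Ω : Type*} {mΩ : MeasurableSpace Ω}
  {grp : Fin d → Fin y} {F : EuclideanSpace ℝ (Fin d) → Ξ → ℝ} {D : Measure Ξ}
  [IsProbabilityMeasure D] {f : EuclideanSpace ℝ (Fin d) → ℝ} {L σ : ℝ} {P : Measure Ω}
  [IsProbabilityMeasure P] {ℱ : Filtration ℕ mΩ} {ξ : ℕ → Fin n → Fin b → Ω → Ξ}
  {S : ℕ → Fin n → Ω → Selection grp}

lemma deviation_of_one (hn : n = 1) (s : State n d) : deviation s = 0 := by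
  subst hn
  simp [deviation, State.average]

/-- The convergence bound in terms of the step size, with any lower bound `c` of the loss in place
of its infimum. -/
lemma SharedData.sum_gradient_le (h : SharedData n b K F D f L σ P ℱ ξ S) (hn : 1 ≤ n)
    (hb : 1 ≤ b)
    (hS : ∀ᵐ ω ∂P, ∀ t, t + p ≤ K → ∀ w j,
      ∃ s, t ≤ s ∧ s < t + p ∧ Selected (S s w ω) j)
    (hL : 0 ≤ L) {γ : ℝ} (hγ : 0 < γ) (hLγ : L * γ ≤ 1)
    (hpγ : 12 * n * (p : ℝ) ^ 2 * (L ^ 2 * γ ^ 2) ≤ 1)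
    {c : ℝ} (hc : ∀ x, c ≤ f x) (x₀ : EuclideanSpace ℝ (Fin d)) :
    ∑ t ∈ Finset.range K, ∫ ω, ‖gradient f (randomRun F γ x₀ ξ S t ω).average‖ ^ 2 ∂P
      ≤ 2 * (2 * (f x₀ - c) / γ + K * (L * γ * σ ^ 2 / (n * b)))
        + 2 * n * K * (p * L ^ 2 * γ ^ 2 * σ ^ 2 / b) := by
  have hn0 : (0 : ℝ) < n := by exact_mod_cast hn
  have hφ0 : ∫ ω, f (randomRun F γ x₀ ξ S 0 ω).average ∂P = f x₀ := by
    have h0 : ∀ ω, (randomRun F γ x₀ ξ S 0 ω).average = x₀ :=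
      fun ω => run_average_zero _ γ x₀ _ _ hn
    simp [h0]
  have hφK : c ≤ ∫ ω, f (randomRun F γ x₀ ξ S K ω).average ∂P := by
    have h1 := integral_mono (integrable_const c) (integrable_smooth_comp h.differentiable
      h.lipschitz hc (h.average_regular γ x₀ hn hb le_rfl).2) fun ω => hc _
    simpa using h1
  rw [← hφ0]
  refine sum_le_of_descent_of_consensus (n := n) (p := p) (q := L ^ 2 * γ ^ 2)
    (φ := fun t => ∫ ω, f (randomRun F γ x₀ ξ S t ω).average ∂P)
    (v := fun t => L ^ 2 / n * ∫ ω, deviation (randomRun F γ x₀ ξ S t ω) ∂P)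
    hγ (by positivity) (by positivity) (fun t => integral_nonneg fun _ => by positivity)
    (fun t => mul_nonneg (by positivity) (integral_nonneg fun _ =>
      Finset.sum_nonneg fun _ _ => by positivity))
    (by positivity) hpγ hn hφK (hφ0.symm ▸ hc x₀) ?_ ?_ ?_
  · intro t ht
    refine (h.descent γ x₀ hn hb hL hγ.le hLγ hc ht).trans (le_of_eq ?_)
    ring
  · intro h1 t
    simp [deviation_of_one h1]
  · intro t ht
    have h1 := mul_le_mul_of_nonneg_left (h.consensus γ x₀ hn hb hS ht)
      (by positivity : 0 ≤ L ^ 2 / n)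
    refine h1.trans (le_of_eq ?_)
    rw [mul_add, Finset.mul_sum, Finset.mul_sum, Finset.mul_sum]
    congr 1
    · field_simp
    · refine Finset.sum_congr rfl fun k _ => ?_
      field_simp

end MergeComp

end

theorem theorem1
    {n d y b p K M : ℕ} (hn : 1 ≤ n) (hb : 1 ≤ b) (hp : 1 ≤ p) (hK : 1 ≤ K)
    -- `M` is the total mini-batch size, each of the `n` workers using `b` samples
    (hM : M = n * b)
    {Ξ : Type*} [MeasurableSpace Ξ]
    (F : Fin n → EuclideanSpace ℝ (Fin d) → Ξ → ℝ)
    (D : Fin n → Measure Ξ) [∀ i, IsProbabilityMeasure (D i)]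
    -- the losses are measurable, differentiable in the model, with well-defined expectations
    (hF_meas : ∀ i, Measurable (fun z : EuclideanSpace ℝ (Fin d) × Ξ => F i z.1 z.2))
    (hF_diff : ∀ i ξ, Differentiable ℝ (fun x => F i x ξ))
    (hF_int : ∀ i x, Integrable (F i x) (D i))
    (hf_diff : ∀ i, Differentiable ℝ (MergeComp.localLoss F D i))
    (hf_bdd : BddBelow (Set.range (MergeComp.globalLoss F D)))
    -- Lipschitz gradients
    (L : ℝ) (hL : 0 ≤ L)
    (hLip : ∀ i x z, ‖gradient (MergeComp.localLoss F D i) x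
      - gradient (MergeComp.localLoss F D i) z‖ ≤ L * ‖x - z‖)
    -- bounded variance
    (σ : ℝ)
    (hVar : ∀ i x,
      Integrable (fun ζ => ‖MergeComp.stochGrad (F i) x ζ
        - gradient (MergeComp.localLoss F D i) x‖ ^ 2) (D i) ∧
      ∫ ζ, ‖MergeComp.stochGrad (F i) x ζ
        - gradient (MergeComp.localLoss F D i) x‖ ^ 2 ∂(D i) ≤ σ ^ 2)
    -- unbiasedness
    (hUnb : ∀ i x, ∫ ζ, MergeComp.stochGrad (F i) x ζ ∂(D i)
      = gradient (MergeComp.localLoss F D i) x)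
    -- all workers share the same training data
    (hShare : ∀ i j, D i = D j ∧ F i = F j)
    -- `ℱ t` is the information available before iteration `t`
    {Ω : Type*} [mΩ : MeasurableSpace Ω] (P : Measure Ω) [IsProbabilityMeasure P]
    (ℱ : Filtration ℕ mΩ)
    -- fresh independent samples in every iteration
    (ξ : ℕ → Fin n → Fin b → Ω → Ξ)
    (hξ_meas : ∀ t < K, ∀ w k, Measurable[ℱ (t + 1)] (ξ t w k))
    (hξ_law : ∀ t < K, ∀ w k, P.map (ξ t w k) = D w)
    (hξ_indep : ∀ t < K, iIndepFun (fun (q : Fin n × Fin b) => ξ t q.1 q.2) P)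
    (hξ_past : ∀ t < K, Indep
      (MeasurableSpace.comap (fun ω (q : Fin n × Fin b) => ξ t q.1 q.2 ω) MeasurableSpace.pi)
      (ℱ t) P)
    -- groupwise sparsifier: the selections may depend on the past, on the current gradients and on
    -- further randomness
    (grp : Fin d → Fin y)
    (S : ℕ → Fin n → Ω → MergeComp.Selection grp)
    (hS_meas : ∀ t < K, ∀ w j, MeasurableSet[ℱ (t + 1)] {ω | MergeComp.Selected (S t w ω) j})
    -- every coordinate is exchanged within any `p` consecutive iterations
    (hS_exch : ∀ᵐ ω ∂P, ∀ t, t + p ≤ K → ∀ w j,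
      ∃ s, t ≤ s ∧ s < t + p ∧ MergeComp.Selected (S s w ω) j)
    (x₀ : EuclideanSpace ℝ (Fin d))
    (θ γ : ℝ) (hθ : 0 < θ) (hγ : γ = θ * √((M : ℝ) / K))
    (hLγ : L * γ ≤ 1)
    (hpγ : 6 * n * (p : ℝ) ^ 2 * L ^ 2 * γ ^ 2 < 1)
    (hKbig : 12 * n * M * θ ^ 2 * (p : ℝ) ^ 2 * L ^ 2 ≤ (K : ℝ)) :
    (∀ t < K, Integrable (fun ω => ‖gradient (MergeComp.globalLoss F D)
      (MergeComp.run F γ x₀ (fun s w k => ξ s w k ω) (fun s w => S s w ω) t).average‖ ^ 2) P) ∧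
    (1 / (K : ℝ)) * ∑ t ∈ Finset.range K, ∫ ω, ‖gradient (MergeComp.globalLoss F D)
        (MergeComp.run F γ x₀ (fun s w k => ξ s w k ω) (fun s w => S s w ω) t).average‖ ^ 2 ∂P
      ≤ (4 * θ⁻¹ * (MergeComp.globalLoss F D x₀ - ⨅ x, MergeComp.globalLoss F D x)
            + 2 * θ * L * σ ^ 2) / √((M : ℝ) * K)
          + 2 * p * (n : ℝ) ^ 2 * θ ^ 2 * L ^ 2 * σ ^ 2 / K ∧
    -- the rate `O(1 / √(M K))`, with a constant independent of `n`, `p`, `M`, `K`, for large `K`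
    ((p : ℝ) ^ 2 * (n : ℝ) ^ 4 * M * θ ^ 2 * L ^ 2 ≤ (K : ℝ) →
      (1 / (K : ℝ)) * ∑ t ∈ Finset.range K, ∫ ω, ‖gradient (MergeComp.globalLoss F D)
          (MergeComp.run F γ x₀ (fun s w k => ξ s w k ω) (fun s w => S s w ω) t).average‖ ^ 2 ∂P
        ≤ (4 * θ⁻¹ * (MergeComp.globalLoss F D x₀ - ⨅ x, MergeComp.globalLoss F D x)
              + 4 * θ * L * σ ^ 2) / √((M : ℝ) * K)) := by
  let w₀ : Fin n := ⟨0, hn⟩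
  obtain ⟨F₀, rfl⟩ : ∃ F₀, F = fun _ => F₀ := ⟨F w₀, funext fun i => (hShare i w₀).2⟩
  obtain ⟨D₀, rfl⟩ : ∃ D₀, D = fun _ => D₀ := ⟨D w₀, funext fun i => (hShare i w₀).1⟩
  have hD₀ : IsProbabilityMeasure D₀ := ‹∀ _ : Fin n, IsProbabilityMeasure D₀› w₀
  set f := MergeComp.globalLoss (fun _ : Fin n => F₀) (fun _ => D₀) with hf
  have hloc : ∀ i, MergeComp.localLoss (fun _ : Fin n => F₀) (fun _ => D₀) i = f := fun i =>
    funext fun x => (MergeComp.average_const hn _).symm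
  simp only [hloc] at hf_diff hLip hVar hUnb
  have hmeas := MergeComp.measurable_stochGrad (hF_meas w₀) (hF_diff w₀)
  have hset : MergeComp.SharedData n b K F₀ D₀ f L σ P ℱ ξ S :=
    { measurable_stochGrad := hmeas
      differentiable := hf_diff w₀
      lipschitz := hLip w₀
      variance := hVar w₀
      unbiased := fun x => by
        have h1 : MemLp (fun ζ => MergeComp.stochGrad F₀ x ζ - gradient f x) 2 D₀ :=
          (memLp_two_iff_integrable_sq_norm ((hmeas.comp measurable_prodMk_left).sub_const
            (gradient f x)).aestronglyMeasurable).2 (hVar w₀ x).1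
        have h2 : Integrable (MergeComp.stochGrad F₀ x) D₀ := by
          simpa [Pi.add_def] using
            (h1.integrable one_le_two).add (integrable_const (gradient f x))
        rw [integral_sub h2 (integrable_const _), hUnb w₀ x]
        simp
      measurable_sample := hξ_meas
      law := hξ_law
      indep := hξ_indep
      indep_past := hξ_past
      measurable_selected := hS_meas }
  have hn0 : (0 : ℝ) < n := by exact_mod_cast hn
  have hb0 : (0 : ℝ) < b := by exact_mod_cast hb
  have hK0 : (0 : ℝ) < K := by exact_mod_cast hK
  have hMnb : (M : ℝ) = n * b := by rw [hM]; push_cast; ring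
  have hM0 : (0 : ℝ) < M := by rw [hMnb]; positivity
  have hγ0 : 0 < γ := by rw [hγ]; positivity
  have hγsq : γ ^ 2 = θ ^ 2 * (M / K) := by
    rw [hγ, mul_pow, Real.sq_sqrt (by positivity)]
  have hq : 12 * n * (p : ℝ) ^ 2 * (L ^ 2 * γ ^ 2) ≤ 1 := by
    rw [hγsq]
    have : 12 * n * (p : ℝ) ^ 2 * (L ^ 2 * (θ ^ 2 * (M / K)))
        = 12 * n * M * θ ^ 2 * (p : ℝ) ^ 2 * L ^ 2 / K := by ring
    rw [this, div_le_one hK0]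
    exact hKbig
  have hsum := hset.sum_gradient_le hn hb hS_exch hL hγ0 hLγ hq (fun x => ciInf_le hf_bdd x) x₀
  have hkm : √((M : ℝ) * K) = √M * √K := Real.sqrt_mul hM0.le _
  have hγ' : γ = θ * (√M / √K) := by rw [hγ, Real.sqrt_div hM0.le]
  have hm0 : 0 < √(M : ℝ) := Real.sqrt_pos.2 hM0
  have hk0 : 0 < √(K : ℝ) := Real.sqrt_pos.2 hK0
  have hmm : √(M : ℝ) ^ 2 = n * b := by rw [Real.sq_sqrt hM0.le, hMnb]
  have hkk : (K : ℝ) = √(K : ℝ) ^ 2 := (Real.sq_sqrt hK0.le).symm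
  have hmain : (1 / (K : ℝ)) * ∑ t ∈ Finset.range K, ∫ ω, ‖gradient f
        (MergeComp.randomRun F₀ γ x₀ ξ S t ω).average‖ ^ 2 ∂P
      ≤ (4 * θ⁻¹ * (f x₀ - ⨅ x, f x) + 2 * θ * L * σ ^ 2) / √((M : ℝ) * K)
          + 2 * p * (n : ℝ) ^ 2 * θ ^ 2 * L ^ 2 * σ ^ 2 / K := by
    refine (mul_le_mul_of_nonneg_left hsum (by positivity)).trans (le_of_eq ?_)
    have e1 : 1 / (K : ℝ) * (2 * (f x₀ - ⨅ x, f x) / γ)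
        = 2 * θ⁻¹ * (f x₀ - ⨅ x, f x) / √((M : ℝ) * K) := by
      rw [hkm, hγ', hkk, Real.sqrt_sq hk0.le]
      field_simp
    have e2 : L * γ * σ ^ 2 / (n * b) = θ * L * σ ^ 2 / √((M : ℝ) * K) := by
      rw [hkm, hγ', ← hmm]
      field_simp
    have e3 : 2 * n * (p * L ^ 2 * γ ^ 2 * σ ^ 2 / b)
        = 2 * p * (n : ℝ) ^ 2 * θ ^ 2 * L ^ 2 * σ ^ 2 / K := by
      rw [hγsq, hMnb]
      field_simp
    calc 1 / (K : ℝ) * (2 * (2 * (f x₀ - ⨅ x, f x) / γ + K * (L * γ * σ ^ 2 / (n * b)))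
          + 2 * n * K * (p * L ^ 2 * γ ^ 2 * σ ^ 2 / b))
        = 2 * (1 / (K : ℝ) * (2 * (f x₀ - ⨅ x, f x) / γ)) + 2 * (L * γ * σ ^ 2 / (n * b))
          + 2 * n * (p * L ^ 2 * γ ^ 2 * σ ^ 2 / b) := by
          field_simp
      _ = _ := by
          rw [e1, e2, e3]
          ring
  refine ⟨fun t ht => hset.integrable_gradient_average γ x₀ hn hb ht.le, hmain, fun hlarge => ?_⟩
  refine hmain.trans ?_
  -- For large `K` the consensus error is at most `2 * θ * L * σ ^ 2 / √(M * K)`.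
  have hroot : p * (n : ℝ) ^ 2 * θ * L * √M ≤ √K := by
    refine Real.le_sqrt_of_sq_le ?_
    rw [mul_pow, Real.sq_sqrt hM0.le]
    linarith [hlarge, show (p * (n : ℝ) ^ 2 * θ * L) ^ 2 * M
      = (p : ℝ) ^ 2 * (n : ℝ) ^ 4 * M * θ ^ 2 * L ^ 2 by ring]
  have hlast : 2 * p * (n : ℝ) ^ 2 * θ ^ 2 * L ^ 2 * σ ^ 2 / K
      ≤ 2 * θ * L * σ ^ 2 / √((M : ℝ) * K) := by
    rw [hkm, div_le_div_iff₀ hK0 (by positivity)]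
    calc 2 * p * (n : ℝ) ^ 2 * θ ^ 2 * L ^ 2 * σ ^ 2 * (√M * √K)
        = 2 * θ * L * σ ^ 2 * √K * (p * (n : ℝ) ^ 2 * θ * L * √M) := by ring
      _ ≤ 2 * θ * L * σ ^ 2 * √K * √K := by gcongr
      _ = 2 * θ * L * σ ^ 2 * K := by rw [mul_assoc, Real.mul_self_sqrt hK0.le]
  calc (4 * θ⁻¹ * (f x₀ - ⨅ x, f x) + 2 * θ * L * σ ^ 2) / √((M : ℝ) * K)
          + 2 * p * (n : ℝ) ^ 2 * θ ^ 2 * L ^ 2 * σ ^ 2 / K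
      ≤ (4 * θ⁻¹ * (f x₀ - ⨅ x, f x) + 2 * θ * L * σ ^ 2) / √((M : ℝ) * K)
          + 2 * θ * L * σ ^ 2 / √((M : ℝ) * K) := by gcongr
    _ = _ := by rw [← add_div]; ring
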